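/- Let $T$ be a text over a linearly ordered alphabet $\Sigma$ of finite size $\sigma\ge 2$ whose last character occurs nowhere else in $T$. A substring $w$ of $T$ that occurs at least twice is a maximal repeat if every $wa$ and every $aw$ ($a\in\Sigma$) occurs strictly fewer times in $T$ than $w$ (the empty string is counted as occurring $|T|+1$ times); $\tilde e_T$ is the number of substrings of $T$ of the form $wa$ plus the number of those of the form $aw$, with $w$ a maximal repeat and $a\in\Sigma$. Let $\mathrm{L\text{-}CDAWG}(T)$ be the compact directed acyclic word graph of $T$ (the nodes of which are called type-1) with an additional non-branching type-2 node at the end of the path spelling $au$ whenever $u$ is the longest string represented by a type-1 node, $a\in\Sigma$, $au$ is a substring of $T$, and that path ends in the middle of an edge. The suffix link of this type-2 node is the node of $u$; the suffix link of a type-1 node with longest string $v$ is the node of the longest suffix of $v$ that the node does not represent. Write $e.hi$ for the upper end and $\mathrm{lab}(e)$ for the label string of an edge $e$. For an edge $e$ with $|\mathrm{lab}(e)|\ge 2$ let $\mathrm{esuf}(e)=(e_1,\dots,e_k)$ be the path that starts at the suffix link of $e.hi$ and spells $\mathrm{lab}(e)$, and define recursively $\mathrm{jump}(e)=\mathrm{jump}(e_1)$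 if $k=1$ and $\mathrm{jump}(e)=(e_1,\dots,e_k)$ if $k\ge2$. (1) For every edge $e$ of $\mathrm{L\text{-}CDAWG}(T)$ with $|\mathrm{lab}(e)|\ge2$, $\mathrm{jump}(e)$ is well defined, and it is a path of at least two edges that spells $\mathrm{lab}(e)$. (2) There is an algorithm, a fixed program of a word RAM with words of $w$ bits, $2^w\ge C(|T|+\tilde e_T)$, that accesses characters only by comparing the first characters of two edges, with the following property. Suppose $\mathrm{L\text{-}CDAWG}(T)$ is given in memory without the text and the label strings: for each node its type, its suffix link and the list of its outgoing edges sorted by first character; for each edge its two end points, its first character (accessible through comparisons only) and its label length. Then the algorithm computes all jump links in at most $C\,\tilde e_T\log_2\sigma$ steps, keeping the given structure intact. That is, afterwards memory holds for every edge $e$ with $|\mathrm{lab}(e)|\ge2$ a pointer to a linked list of the edges of $\mathrm{jump}(e)$ in order, where lists may share cells. The constant $C$ and the program do not depend on $T$, $\Sigma$, $\sigma$ or $w$. -/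

import Mathlib

namespace LCDAWG

universe u

variable {α : Type u}

/-! ### Occurrences, maximal repeats and their extensions

Strings over `α` are lists. The empty string occurs at all `|T| + 1` positions of `T`. -/

/-- The beginning positions of the occurrences of `x` in `T`. -/
def begPos (T x : List α) : Set ℕ := {i | i ≤ T.length ∧ x <+: T.drop i}

/-- The ending positions of the occurrences of `x` in `T`. -/
def endPos (T x : List α) : Set ℕ := {j | j ≤ T.length ∧ x <:+ T.take j}

/-- The number of occurrences of `x` in `T`. -/
noncomputable def occ (T x : List α) : ℕ := (begPos T x).ncard

/-- A maximal repeat of `T`: a repeat all of whose left and right extensions occur strictly fewer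
times. -/
def IsMaximalRepeat (T w : List α) : Prop :=
  1 < occ T w ∧
    (∀ a : α, w ++ [a] <:+: T → occ T (w ++ [a]) < occ T w) ∧
    (∀ a : α, a :: w <:+: T → occ T (a :: w) < occ T w)

/-- The right extensions of maximal repeats that appear in `T`. -/
def rightExtensions (T : List α) : Set (List α) :=
  {y | ∃ (w : List α) (a : α), IsMaximalRepeat T w ∧ y = w ++ [a] ∧ y <:+: T}

/-- The left extensions of maximal repeats that appear in `T`. -/
def leftExtensions (T : List α) : Set (List α) :=
  {y | ∃ (w : List α) (a : α), IsMaximalRepeat T w ∧ y = a :: w ∧ y <:+: T}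

/-- `ẽ_T`: the number of right extensions plus the number of left extensions. -/
noncomputable def numExtensions (T : List α) : ℕ :=
  (rightExtensions T).ncard + (leftExtensions T).ncard

/-- `T` ends with a character that appears nowhere else in `T`. -/
def EndsWithUniqueChar (T : List α) : Prop := ∃ (S : List α) (d : α), T = S ++ [d] ∧ d ∉ S

/-! ### CDAWG -/

/-- The class of `x` for `≡_L`: the strings with the same beginning positions in `T`. -/
def classL (T x : List α) : Set (List α) := {y | begPos T y = begPos T x}

/-- The class of `x` for `≡_R`: the strings with the same ending positions in `T`. -/
def classR (T x : List α) : Set (List α) := {y | endPos T y = endPos T x}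

/-- `y` is a longest member of the set `S`. -/
def IsLongest (S : Set (List α)) (y : List α) : Prop := y ∈ S ∧ ∀ z ∈ S, z.length ≤ y.length

/-- `y` is the longest member of the `≡_L`-class of some substring of `T`. -/
def IsLRep (T y : List α) : Prop := ∃ x : List α, x <:+: T ∧ IsLongest (classL T x) y

/-- The nodes of `CDAWG(T)`. -/
def IsCNode (T : List α) (c : Set (List α)) : Prop := ∃ y : List α, IsLRep T y ∧ c = classR T y

/-- The edges `(c, x, c')` of `CDAWG(T)`: from the class of `y` (with `y` longest in its
`≡_L`-class) there is one outgoing edge for each character `a` with `ya` a substring of `T`; its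
label `x` extends `y` to the longest member `yx` of the `≡_L`-class of `ya`. -/
def IsCEdge (T : List α) (c : Set (List α)) (x : List α) (c' : Set (List α)) : Prop :=
  ∃ (y : List α) (a : α), IsLRep T y ∧ c = classR T y ∧ y ++ [a] <:+: T ∧
    IsLongest (classL T (y ++ [a])) (y ++ x) ∧ c' = classR T (y ++ x)

/-- `Spells T c z`: a path of `CDAWG(T)` from the source to the node `c` spells out `z`. -/
inductive Spells (T : List α) : Set (List α) → List α → Prop
  | source : Spells T (classR T []) []
  | step {c c' : Set (List α)} {z x : List α} :
      Spells T c z → IsCEdge T c x c' → Spells T c' (z ++ x)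

/-! ### L-CDAWG -/

/-- A position in `CDAWG(T)`: the node `base` if `off = []`; otherwise the point inside the
outgoing edge of `base` whose label has `off` as a proper prefix, reached after reading `off`. -/
@[ext]
structure Pos (α : Type u) where
  base : Set (List α)
  off : List α

/-- Type-1 nodes: the nodes of `CDAWG(T)`. -/
def IsType1 (T : List α) (v : Pos α) : Prop := IsCNode T v.base ∧ v.off = []

/-- `v` is the type-2 node representing `a u`, where `u` is the value (longest member) of a type-1
node: `a u` is a substring of `T` and the path spelling out `a u` ends at `v`, in the middle of an
edge. -/
def IsType2For (T : List α) (v : Pos α) (a : α) (u : List α) : Prop :=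
  (∃ c, IsCNode T c ∧ IsLongest c u) ∧ a :: u <:+: T ∧
    (∃ z, Spells T v.base z ∧ a :: u = z ++ v.off) ∧
    v.off ≠ [] ∧ ∃ x c', IsCEdge T v.base x c' ∧ v.off <+: x ∧ v.off ≠ x

def IsType2 (T : List α) (v : Pos α) : Prop := ∃ a u, IsType2For T v a u

/-- The nodes of `L-CDAWG(T)`. -/
def IsNode (T : List α) (v : Pos α) : Prop := IsType1 T v ∨ IsType2 T v

/-- An edge from `hi` to `lo`, with its original label string. -/
@[ext]
structure Edge (α : Type u) where
  hi : Pos α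
  lab : List α
  lo : Pos α

/-- The string length of an edge. -/
def Edge.slen (e : Edge α) : ℕ := e.lab.length

/-- The edges of `L-CDAWG(T)`: the pieces into which the type-2 nodes split the edges of
`CDAWG(T)`. -/
def IsEdge (T : List α) (e : Edge α) : Prop :=
  IsNode T e.hi ∧ IsNode T e.lo ∧ e.lab ≠ [] ∧
    (∃ x c', IsCEdge T e.hi.base x c' ∧
      ((e.hi.off ++ e.lab = x ∧ e.lo = ⟨c', []⟩) ∨
        (e.hi.off ++ e.lab <+: x ∧ e.hi.off ++ e.lab ≠ x ∧
          e.lo = ⟨e.hi.base, e.hi.off ++ e.lab⟩))) ∧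
    ∀ p : List α, p ≠ [] → p <+: e.lab → p ≠ e.lab → ¬ IsNode T ⟨e.hi.base, e.hi.off ++ p⟩

/-- `IsSlink T v w`: the suffix link of `v` is `w`. For a type-1 node, `w` is the node of the
longest suffix of the value of `v` that does not belong to `v`; for the type-2 node representing
`a u` it is the type-1 node of `u`. The source has no suffix link. -/
def IsSlink (T : List α) (v w : Pos α) : Prop :=
  (IsType1 T v ∧ ∃ x, IsLongest v.base x ∧
      ∃ s, IsLongest {y | y <:+ x ∧ y ∉ v.base} s ∧ w = ⟨classR T s, []⟩) ∨
    ∃ a u, IsType2For T v a u ∧ w = ⟨classR T u, []⟩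

/-! ### Paths, edge suffix links and jump links -/

/-- `IsPath T v p w`: the list of edges `p` is a path of `L-CDAWG(T)` from `v` to `w`. -/
def IsPath (T : List α) : Pos α → List (Edge α) → Pos α → Prop
  | v, [], w => v = w
  | v, e :: p, w => IsEdge T e ∧ e.hi = v ∧ IsPath T e.lo p w

/-- The label string of a path. -/
def pathLab (p : List (Edge α)) : List α := p.flatMap Edge.lab

/-- `p` is the edge suffix link of `e`: the path from `slink(e.hi)` obtained by scanning
`lab(e)`. -/
def IsESuf (T : List α) (e : Edge α) (p : List (Edge α)) : Prop :=
  ∃ v w, IsSlink T e.hi v ∧ IsPath T v p w ∧ pathLab p = e.lab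

/-- `IsJump T e p`: `jump(e) = p`, by the recursive definition of jump links. -/
inductive IsJump (T : List α) : Edge α → List (Edge α) → Prop
  | single {e e₁ : Edge α} {p : List (Edge α)} :
      IsEdge T e → 2 ≤ e.slen → IsESuf T e [e₁] → IsJump T e₁ p → IsJump T e p
  | path {e : Edge α} {p : List (Edge α)} :
      IsEdge T e → 2 ≤ e.slen → IsESuf T e p → 2 ≤ p.length → IsJump T e p

/-! ### The machine: a word RAM in the comparison model

A program uses finitely many registers and finitely many arrays of words. Every elementary
operation and every test costs one time unit. The characters are not words: the only access to
them is the test `chr`, which asks whether the first character of the edge numbered by one register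
is smaller than that of the edge numbered by another register. -/

/-- Memory: registers `reg r` and array cells `mem k i`. -/
@[ext]
structure State where
  reg : ℕ → ℕ
  mem : ℕ → ℕ → ℕ

/-- Elementary operations on registers. -/
inductive Op
  | const (n : ℕ)
  | copy (a : ℕ)
  | add (a b : ℕ)
  | sub (a b : ℕ)
  | half (a : ℕ)
  | load (k a : ℕ)

/-- The value computed by an operation; `sub` is truncated and `load k a` reads the cell of the
array `k` whose index is in register `a`. -/
def Op.val (s : State) : Op → ℕ
  | .const n => n
  | .copy a => s.reg a
  | .add a b => s.reg a + s.reg b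
  | .sub a b => s.reg a - s.reg b
  | .half a => s.reg a / 2
  | .load k a => s.mem k (s.reg a)

/-- Tests on registers. -/
inductive Test
  | lt (a b : ℕ)
  | eq (a b : ℕ)
  | chr (a b : ℕ)

/-- Truth of a test; `cmp` is the character comparison. -/
def Test.Holds (cmp : ℕ → ℕ → Prop) (s : State) : Test → Prop
  | .lt a b => s.reg a < s.reg b
  | .eq a b => s.reg a = s.reg b
  | .chr a b => cmp (s.reg a) (s.reg b)

/-- Programs. `set d o` writes the value of `o` to register `d`; `store k a b` writes register `b`
to the cell of array `k` whose index is in register `a`. -/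
inductive Prog
  | set (d : ℕ) (o : Op)
  | store (k a b : ℕ)
  | seq (p q : Prog)
  | ite (c : Test) (p q : Prog)
  | while (c : Test) (p : Prog)

/-- `Exec cmp w p s t s'`: with words of `w` bits, `p` started in `s` halts in `s'` after exactly
`t` time units. A program that computes a number not fitting in a word gets stuck. -/
inductive Exec (cmp : ℕ → ℕ → Prop) (w : ℕ) : Prog → State → ℕ → State → Prop
  | set {d : ℕ} {o : Op} {s : State} : o.val s < 2 ^ w →
      Exec cmp w (.set d o) s 1 ⟨Function.update s.reg d (o.val s), s.mem⟩
  | store {k a b : ℕ} {s : State} :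
      Exec cmp w (.store k a b) s 1
        ⟨s.reg, Function.update s.mem k (Function.update (s.mem k) (s.reg a) (s.reg b))⟩
  | seq {p q : Prog} {s₁ s₂ s₃ : State} {t₁ t₂ : ℕ} :
      Exec cmp w p s₁ t₁ s₂ → Exec cmp w q s₂ t₂ s₃ → Exec cmp w (.seq p q) s₁ (t₁ + t₂) s₃
  | ite_true {c : Test} {p q : Prog} {s s' : State} {t : ℕ} :
      c.Holds cmp s → Exec cmp w p s t s' → Exec cmp w (.ite c p q) s (t + 1) s'
  | ite_false {c : Test} {p q : Prog} {s s' : State} {t : ℕ} :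
      ¬ c.Holds cmp s → Exec cmp w q s t s' → Exec cmp w (.ite c p q) s (t + 1) s'
  | while_true {c : Test} {p : Prog} {s₁ s₂ s₃ : State} {t₁ t₂ : ℕ} :
      c.Holds cmp s₁ → Exec cmp w p s₁ t₁ s₂ → Exec cmp w (.while c p) s₂ t₂ s₃ →
        Exec cmp w (.while c p) s₁ (t₁ + t₂ + 1) s₃
  | while_false {c : Test} {p : Prog} {s : State} :
      ¬ c.Holds cmp s → Exec cmp w (.while c p) s 1 s

/-- All registers and cells hold `w`-bit words. -/
def State.IsWordState (w : ℕ) (s : State) : Prop :=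
  (∀ r, s.reg r < 2 ^ w) ∧ ∀ k i, s.mem k i < 2 ^ w

/-! ### `L-CDAWG(T)` in memory -/

/-- The first character of `e` is smaller than that of `f`. -/
def FirstCharLT [LT α] (e f : Edge α) : Prop :=
  ∃ a b x y, e.lab = a :: x ∧ f.lab = b :: y ∧ a < b

/-- A numbering of the nodes and of the edges of `L-CDAWG(T)`, in which the edges leaving the same
node are numbered by increasing first characters. -/
structure Layout [LT α] (T : List α) where
  N : ℕ
  M : ℕ
  node : Fin N ≃ {v : Pos α // IsNode T v}
  edge : Fin M ≃ {e : Edge α // IsEdge T e}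
  sorted : ∀ i j : Fin M, i < j → (edge i).1.hi = (edge j).1.hi →
    FirstCharLT (edge i).1 (edge j).1

/-- The comparison of first characters of numbered edges. -/
def Layout.cmp [LT α] {T : List α} (G : Layout T) (i j : ℕ) : Prop :=
  ∃ (hi : i < G.M) (hj : j < G.M), FirstCharLT (G.edge ⟨i, hi⟩).1 (G.edge ⟨j, hj⟩).1

/-- The state `s` stores `L-CDAWG(T)`: registers 0 and 1 hold the numbers of nodes and edges;
arrays 0, 1, 2, 3 hold for each node its type, its suffix link, and the bounds of the interval of
the numbers of its outgoing edges; arrays 4, 5, 6 hold for each edge `e` its end points `e.hi`,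
`e.lo` and its string length. The text and the edge labels are not stored. -/
structure Layout.Stored [LT α] {T : List α} (G : Layout T) (s : State) : Prop where
  numNodes : s.reg 0 = G.N
  numEdges : s.reg 1 = G.M
  type1 : ∀ v : Fin G.N, IsType1 T (G.node v).1 → s.mem 0 v = 1
  type2 : ∀ v : Fin G.N, IsType2 T (G.node v).1 → s.mem 0 v = 2
  slink : ∀ v v' : Fin G.N, IsSlink T (G.node v).1 (G.node v').1 → s.mem 1 v = v'
  out : ∀ (v : Fin G.N) (i : ℕ), (s.mem 2 v ≤ i ∧ i < s.mem 3 v) ↔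
    ∃ h : i < G.M, (G.edge ⟨i, h⟩).1.hi = (G.node v).1
  hi : ∀ (i : Fin G.M) (v : Fin G.N), (G.edge i).1.hi = (G.node v).1 → s.mem 4 i = v
  lo : ∀ (i : Fin G.M) (v : Fin G.N), (G.edge i).1.lo = (G.node v).1 → s.mem 5 i = v
  slen : ∀ i : Fin G.M, s.mem 6 i = (G.edge i).1.slen

/-- `ListAt s a l`: the linked list starting at the address `a` has the entries `l`. A cell at
address `a ≠ 0` has its entry in array 8 and the address of the next cell in array 9; the address
`0` is the empty list. -/
inductive ListAt (s : State) : ℕ → List ℕ → Prop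
  | nil : ListAt s 0 []
  | cons {a : ℕ} {l : List ℕ} :
      a ≠ 0 → ListAt s (s.mem 9 a) l → ListAt s a (s.mem 8 a :: l)

/-- All jump links are stored: for every edge with string length at least 2, the entry of array 7
is the address of a linked list of the numbers of the edges of its jump path. -/
def Layout.JumpsStored [LT α] {T : List α} (G : Layout T) (s : State) : Prop :=
  ∀ (i : Fin G.M) (p : List (Edge α)), 2 ≤ (G.edge i).1.slen → IsJump T (G.edge i).1 p →
    ∃ l : List (Fin G.M), l.map (fun j => (G.edge j).1) = p ∧
      ListAt s (s.mem 7 i) (l.map (fun j => (j : ℕ)))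

end LCDAWG

universe u

open LCDAWG

/-!
Let `c :: s` be the shortest string of the node `e.hi` of an edge `e` with `|lab(e)| ≥ 2`. The
suffix link of `e.hi` is the node of `s`, where `s = u` if `e.hi` is the type-2 node of `au`.
Reading `lab(e)` from `s`, the first right-maximal string is met exactly at the end: one met
earlier, at `s ++ p`, would make the path of `c :: s ++ p` end at a node of `L-CDAWG(T)` inside `e`.
So the path `esuf(e)` consists of consecutive pieces of a single edge of the CDAWG. Since type-2
nodes have out-degree one, the path is determined by its first edge, and its cells can be shared by
all edge suffix links that pass through it.

A type-1 node has at most one edge for each right extension of its value, and every type-2 node is a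
left extension, so there are at most `ẽ` edges. Binary search among the outgoing edges of the suffix
link finds the first edge of `esuf(e)` with `O(log σ)` comparisons. Following the edge suffix links
that consist of one edge only, with path compression, resolves one new edge for each link followed.
-/

namespace LCDAWG

variable {α : Type u}

theorem exists_isLongest {S : Set (List α)} (hS : S.Nonempty) (hbdd : BddAbove (List.length '' S)) :
    ∃ x, IsLongest S x := by
  obtain ⟨x, hx, hlen⟩ := Nat.sSup_mem (hS.image _) hbdd
  exact ⟨x, hx, fun z hz => hlen ▸ le_csSup hbdd ⟨z, hz, rfl⟩⟩

theorem exists_minimal_prefix {P : List α → Prop} {r : List α} (hr : P r) :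
    ∃ p, p <+: r ∧ P p ∧ ∀ q, q <+: p → P q → q = p := by
  obtain ⟨p, ⟨hpr, hp⟩, hmin⟩ := exists_minimalFor_of_wellFoundedLT
    (fun p => p <+: r ∧ P p) List.length ⟨r, List.prefix_rfl, hr⟩
  exact ⟨p, hpr, hp, fun q hqp hq =>
    hqp.eq_of_length_le (hmin ⟨hqp.trans hpr, hq⟩ hqp.length_le)⟩

theorem prefix_append_cases {p q r : List α} (h : p <+: q ++ r) :
    p <+: q ∨ ∃ s, s ≠ [] ∧ s <+: r ∧ p = q ++ s := by
  rcases List.prefix_or_prefix_of_prefix h (List.prefix_append q r) with hpq | ⟨s, rfl⟩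
  · exact .inl hpq
  · rcases eq_or_ne s [] with rfl | hs
    · exact .inl (by rw [List.append_nil])
    · exact .inr ⟨s, hs, (List.prefix_append_right_inj q).1 h, rfl⟩

/-! ### Occurrences -/

theorem mem_begPos {T x : List α} {i : ℕ} :
    i ∈ begPos T x ↔ ∃ p q, T = p ++ x ++ q ∧ i = p.length := by
  constructor
  · rintro ⟨hi, q, hq⟩
    refine ⟨T.take i, q, ?_, (List.length_take_of_le hi).symm⟩
    rw [List.append_assoc, hq, List.take_append_drop]
  · rintro ⟨p, q, rfl, rfl⟩
    simp [begPos]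

theorem mem_endPos {T x : List α} {j : ℕ} :
    j ∈ endPos T x ↔ ∃ p q, T = p ++ x ++ q ∧ j = p.length + x.length := by
  constructor
  · rintro ⟨hj, p, hp⟩
    refine ⟨p, T.drop j, by rw [hp, List.take_append_drop], ?_⟩
    rw [← List.length_append, hp, List.length_take_of_le hj]
  · rintro ⟨p, q, rfl, rfl⟩
    rw [← List.length_append]
    exact ⟨by simp, by rw [List.take_left]; exact List.suffix_append p x⟩

theorem endPos_eq_image (T x : List α) : endPos T x = (· + x.length) '' begPos T x := by
  ext j
  simp only [mem_endPos, Set.mem_image, mem_begPos]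
  constructor
  · rintro ⟨p, q, h, rfl⟩
    exact ⟨_, ⟨p, q, h, rfl⟩, rfl⟩
  · rintro ⟨_, ⟨p, q, h, rfl⟩, rfl⟩
    exact ⟨p, q, h, rfl⟩

theorem add_length_mem_endPos {T x : List α} {i : ℕ} :
    i + x.length ∈ endPos T x ↔ i ∈ begPos T x := by
  rw [endPos_eq_image]
  exact (add_left_injective x.length).mem_set_image

theorem length_le_of_mem_endPos {T x : List α} {j : ℕ} (h : j ∈ endPos T x) : x.length ≤ j := by
  obtain ⟨p, q, -, rfl⟩ := mem_endPos.1 h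
  exact Nat.le_add_left _ _

theorem finite_begPos (T x : List α) : (begPos T x).Finite :=
  (Set.finite_Iic T.length).subset fun _ h => h.1

theorem finite_endPos (T x : List α) : (endPos T x).Finite :=
  (Set.finite_Iic T.length).subset fun _ h => h.1

theorem occ_eq_ncard_endPos (T x : List α) : occ T x = (endPos T x).ncard := by
  rw [endPos_eq_image, Set.ncard_image_of_injective _ (add_left_injective _), occ]

theorem begPos_nonempty {T x : List α} : (begPos T x).Nonempty ↔ x <:+: T := by
  constructor
  · rintro ⟨i, hi⟩
    obtain ⟨p, q, h, -⟩ := mem_begPos.1 hi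
    exact ⟨p, q, h.symm⟩
  · rintro ⟨p, q, h⟩
    exact ⟨_, mem_begPos.2 ⟨p, q, h.symm, rfl⟩⟩

theorem endPos_nonempty {T x : List α} : (endPos T x).Nonempty ↔ x <:+: T := by
  rw [endPos_eq_image, Set.image_nonempty, begPos_nonempty]

theorem infix_congr {T x y : List α} (h : endPos T x = endPos T y) : x <:+: T ↔ y <:+: T := by
  rw [← endPos_nonempty, ← endPos_nonempty, h]

theorem infix_of_append {T x y : List α} (h : x ++ y <:+: T) : x <:+: T :=
  (List.prefix_append x y).isInfix.trans h

theorem endPos_anti {T x y : List α} (h : y <:+ x) : endPos T x ⊆ endPos T y :=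
  fun _ hj => ⟨hj.1, h.trans hj.2⟩

theorem begPos_anti {T x y : List α} (h : y <+: x) : begPos T x ⊆ begPos T y :=
  fun _ hj => ⟨hj.1, h.trans hj.2⟩

theorem suffix_of_mem_endPos {T x y : List α} {j : ℕ} (hx : j ∈ endPos T x)
    (hy : j ∈ endPos T y) (h : y.length ≤ x.length) : y <:+ x :=
  List.suffix_of_suffix_length_le hy.2 hx.2 h

theorem prefix_of_mem_begPos {T x y : List α} {i : ℕ} (hx : i ∈ begPos T x)
    (hy : i ∈ begPos T y) (h : y.length ≤ x.length) : y <+: x :=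
  List.prefix_of_prefix_length_le hy.2 hx.2 h

theorem succ_mem_endPos_append_singleton {T x : List α} {a : α} {j : ℕ} :
    j + 1 ∈ endPos T (x ++ [a]) ↔ j ∈ endPos T x ∧ T[j]? = some a := by
  constructor
  · intro h
    obtain ⟨p, q, rfl, hj⟩ := mem_endPos.1 h
    obtain rfl : j = p.length + x.length := by
      simp only [List.length_append, List.length_singleton] at hj
      omega
    exact ⟨mem_endPos.2 ⟨p, a :: q, by simp, rfl⟩, by simp [← List.append_assoc, add_assoc]⟩
  · rintro ⟨h, ha⟩
    obtain ⟨p, q, rfl, rfl⟩ := mem_endPos.1 h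
    obtain ⟨q, rfl⟩ : ∃ q', q = a :: q' := by
      rw [← List.length_append, List.getElem?_append_right le_rfl, Nat.sub_self,
        ← List.head?_eq_getElem?] at ha
      exact ⟨q.tail, (List.cons_head?_tail ha).symm⟩
    exact mem_endPos.2 ⟨p, q, by simp, by simp [add_assoc]⟩

theorem endPos_append_congr {T x y : List α} (h : endPos T x = endPos T y) (p : List α) :
    endPos T (x ++ p) = endPos T (y ++ p) := by
  induction p using List.reverseRecOn with
  | nil => simpa only [List.append_nil] using h
  | append_singleton p a ih =>
    ext j
    rw [← List.append_assoc, ← List.append_assoc]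
    cases j with
    | zero => constructor <;> intro hj <;> simpa using length_le_of_mem_endPos hj
    | succ j => rw [succ_mem_endPos_append_singleton, succ_mem_endPos_append_singleton, ih]

theorem classR_eq_classR {T x y : List α} : classR T x = classR T y ↔ endPos T x = endPos T y :=
  ⟨fun h => (h ▸ rfl : x ∈ classR T y), fun h => by rw [classR, h, classR]⟩

/-! ### Right-maximal strings -/

/-- `x` is followed by the character `c` at all its occurrences in `T`. -/
def FollowedBy (T x : List α) (c : α) : Prop := ∀ j ∈ endPos T x, T[j]? = some c

/-- The right-maximal substrings of `T`, those not always followed by the same character. They are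
the longest members of the `≡_L`-classes, hence the strings read at the nodes of the CDAWG. -/
def RightMaximal (T x : List α) : Prop := x <:+: T ∧ ∀ c, ¬ FollowedBy T x c

theorem exists_followedBy {T x : List α} (hx : x <:+: T) (h : ¬ RightMaximal T x) :
    ∃ c, FollowedBy T x c := by
  by_contra! hne
  exact h ⟨hx, hne⟩

theorem RightMaximal.of_endPos_subset {T x y : List α} (hx : RightMaximal T x)
    (h : endPos T x ⊆ endPos T y) : RightMaximal T y :=
  ⟨endPos_nonempty.1 ((endPos_nonempty.2 hx.1).mono h),
    fun c hc => hx.2 c fun j hj => hc j (h hj)⟩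

theorem RightMaximal.of_suffix {T x y : List α} (hx : RightMaximal T x) (h : y <:+ x) :
    RightMaximal T y :=
  hx.of_endPos_subset (endPos_anti h)

theorem rightMaximal_congr {T x y : List α} (h : endPos T x = endPos T y) :
    RightMaximal T x ↔ RightMaximal T y :=
  ⟨fun hx => hx.of_endPos_subset h.le, fun hy => hy.of_endPos_subset h.ge⟩

theorem rightMaximal_of_suffix {T x : List α} (h : x <:+ T) : RightMaximal T x := by
  have hmem : T.length ∈ endPos T x := ⟨le_rfl, by rwa [List.take_length]⟩
  refine ⟨h.isInfix, fun c hc => ?_⟩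
  simpa using hc _ hmem

theorem rightMaximal_nil (T : List α) : RightMaximal T [] := rightMaximal_of_suffix List.nil_suffix

theorem followedBy_iff {T x : List α} {c : α} :
    FollowedBy T x c ↔ begPos T (x ++ [c]) = begPos T x := by
  have hadd (i : ℕ) : i ∈ begPos T (x ++ [c]) ↔
      i ∈ begPos T x ∧ T[i + x.length]? = some c := by
    rw [← add_length_mem_endPos, List.length_append, List.length_singleton, ← add_assoc,
      succ_mem_endPos_append_singleton, add_length_mem_endPos]
  simp only [FollowedBy, endPos_eq_image, Set.forall_mem_image, Set.ext_iff, hadd,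
    and_iff_left_iff_imp]

theorem FollowedBy.append_infix {T x : List α} {c : α} (h : FollowedBy T x c) (hx : x <:+: T) :
    x ++ [c] <:+: T := by
  rwa [← begPos_nonempty, followedBy_iff.1 h, begPos_nonempty]

theorem FollowedBy.eq_of_infix {T x : List α} {c d : α} (h : FollowedBy T x c)
    (hd : x ++ [d] <:+: T) : d = c := by
  obtain ⟨j, hj⟩ := endPos_nonempty.2 hd
  cases j with
  | zero => simpa using length_le_of_mem_endPos hj
  | succ j =>
    obtain ⟨hjx, hjd⟩ := succ_mem_endPos_append_singleton.1 hj
    exact Option.some.inj (hjd.symm.trans (h j hjx))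

theorem eq_of_not_rightMaximal {T x : List α} {c d : α} (h : ¬ RightMaximal T x)
    (hc : x ++ [c] <:+: T) (hd : x ++ [d] <:+: T) : c = d := by
  obtain ⟨b, hb⟩ := exists_followedBy (infix_of_append hc) h
  rw [hb.eq_of_infix hc, hb.eq_of_infix hd]

theorem begPos_append_of_not_rightMaximal {T w r : List α} (hr : w ++ r <:+: T)
    (h : ∀ p, p <+: r → RightMaximal T (w ++ p) → p = r) : begPos T (w ++ r) = begPos T w := by
  induction r using List.reverseRecOn with
  | nil => rw [List.append_nil]
  | append_singleton r c ih =>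
    rw [← List.append_assoc] at hr ⊢
    have hwr : ¬ RightMaximal T (w ++ r) := fun hm => by
      simpa using h r (List.prefix_append r [c]) hm
    obtain ⟨d, hd⟩ := exists_followedBy (infix_of_append hr) hwr
    obtain rfl := hd.eq_of_infix hr
    rw [followedBy_iff.1 hd]
    refine ih (infix_of_append hr) fun p hp hm => ?_
    have hlen := congrArg List.length (h p (hp.trans (List.prefix_append r [c])) hm)
    have := hp.length_le
    simp only [List.length_append, List.length_singleton] at hlen
    omega

theorem RightMaximal.isLongest {T x : List α} (h : RightMaximal T x) :
    IsLongest (classL T x) x := by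
  refine ⟨rfl, fun z (hz : begPos T z = begPos T x) => ?_⟩
  by_contra! hlt
  obtain ⟨i, hi⟩ := begPos_nonempty.2 h.1
  obtain ⟨r, rfl⟩ := prefix_of_mem_begPos (hz ▸ hi) hi hlt.le
  cases r with
  | nil => simp at hlt
  | cons c r =>
    refine h.2 c (followedBy_iff.2 ((begPos_anti (List.prefix_append _ _)).antisymm ?_))
    rw [← hz]
    exact begPos_anti ⟨r, by simp⟩

theorem isLRep_iff {T x : List α} : IsLRep T x ↔ RightMaximal T x := by
  constructor
  · rintro ⟨y, hy, hx : begPos T x = begPos T y, hmax⟩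
    refine ⟨by rwa [← begPos_nonempty, hx, begPos_nonempty], fun c hc => ?_⟩
    simpa using hmax (x ++ [c]) ((followedBy_iff.1 hc).trans hx)
  · exact fun h => ⟨x, h.1, h.isLongest⟩

/-! ### The next right-maximal string -/

/-- No extension of `w` by a nonempty prefix of `o` is right-maximal: reading `o` from `w` meets no
node of the CDAWG. -/
def NoRightMaximalAlong (T w o : List α) : Prop :=
  ∀ p, p ≠ [] → p <+: o → ¬ RightMaximal T (w ++ p)

theorem noRightMaximalAlong_nil (T w : List α) : NoRightMaximalAlong T w [] :=
  fun _ hp hpn => absurd (List.prefix_nil.1 hpn) hp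

theorem noRightMaximalAlong_singleton {T w : List α} {c : α} (h : ¬ RightMaximal T (w ++ [c])) :
    NoRightMaximalAlong T w [c] := by
  intro p hp hpc
  rcases List.prefix_cons_iff.1 hpc with rfl | ⟨q, rfl, hq⟩
  · exact absurd rfl hp
  · rwa [List.prefix_nil.1 hq]

theorem NoRightMaximalAlong.mono {T w o o' : List α} (h : NoRightMaximalAlong T w o)
    (ho : o' <+: o) : NoRightMaximalAlong T w o' :=
  fun p hp hpo => h p hp (hpo.trans ho)

theorem NoRightMaximalAlong.append {T w p q : List α} (hp : NoRightMaximalAlong T w p)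
    (hq : NoRightMaximalAlong T (w ++ p) q) : NoRightMaximalAlong T w (p ++ q) := by
  intro r hr hrpq
  rcases prefix_append_cases hrpq with hrp | ⟨s, hs, hsq, rfl⟩
  · exact hp r hr hrp
  · rw [← List.append_assoc]
    exact hq s hs hsq

/-- `w ++ r` is the shortest right-maximal proper extension of `w` along `r`. -/
structure NextRightMaximal (T w r : List α) : Prop where
  ne_nil : r ≠ []
  rightMaximal : RightMaximal T (w ++ r)
  eq_of_prefix : ∀ p, p ≠ [] → p <+: r → RightMaximal T (w ++ p) → p = r

theorem NextRightMaximal.congr {T w w' r : List α} (h : NextRightMaximal T w r)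
    (he : endPos T w = endPos T w') : NextRightMaximal T w' r where
  ne_nil := h.ne_nil
  rightMaximal := (rightMaximal_congr (endPos_append_congr he r)).1 h.rightMaximal
  eq_of_prefix p hp hpr hm :=
    h.eq_of_prefix p hp hpr ((rightMaximal_congr (endPos_append_congr he p)).2 hm)

theorem NextRightMaximal.noRightMaximalAlong {T w r p : List α} (h : NextRightMaximal T w r)
    (hpr : p <+: r) (hne : p ≠ r) : NoRightMaximalAlong T w p := fun q hq hqp hm =>
  hne (hpr.eq_of_length_le (h.eq_of_prefix q hq (hqp.trans hpr) hm ▸ hqp.length_le))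

theorem nextRightMaximal_append {T w p r : List α} (hp : NoRightMaximalAlong T w p)
    (h : NextRightMaximal T (w ++ p) r) : NextRightMaximal T w (p ++ r) where
  ne_nil := List.append_ne_nil_of_right_ne_nil _ h.ne_nil
  rightMaximal := by simpa only [List.append_assoc] using h.rightMaximal
  eq_of_prefix q hq hqpr hm := by
    rcases prefix_append_cases hqpr with hqp | ⟨s, hs, hsr, rfl⟩
    · exact absurd hm (hp q hq hqp)
    · rw [h.eq_of_prefix s hs hsr (by rwa [List.append_assoc])]

theorem NextRightMaximal.of_append {T w p r : List α} (h : NextRightMaximal T w (p ++ r))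
    (hr : r ≠ []) : NextRightMaximal T (w ++ p) r where
  ne_nil := hr
  rightMaximal := by simpa only [List.append_assoc] using h.rightMaximal
  eq_of_prefix q hq hqr hm :=
    List.append_cancel_left (h.eq_of_prefix (p ++ q) (List.append_ne_nil_of_right_ne_nil _ hq)
      ((List.prefix_append_right_inj p).2 hqr) (by rwa [← List.append_assoc]))

theorem NextRightMaximal.begPos_eq {T w r : List α} {a : α} (h : NextRightMaximal T w (a :: r)) :
    begPos T (w ++ a :: r) = begPos T (w ++ [a]) := by
  rw [List.append_cons]
  refine begPos_append_of_not_rightMaximal (by simpa using h.rightMaximal.1) fun p hp hm => ?_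
  have hap := h.eq_of_prefix (a :: p) (List.cons_ne_nil a p) (List.cons_prefix_cons.2 ⟨rfl, hp⟩)
    (by simpa using hm)
  exact (List.cons.inj hap).2

theorem NextRightMaximal.isLongest {T w r : List α} {a : α}
    (h : NextRightMaximal T w (a :: r)) : IsLongest (classL T (w ++ [a])) (w ++ a :: r) := by
  have := h.rightMaximal.isLongest
  rwa [classL, h.begPos_eq] at this

theorem nextRightMaximal_of_isLongest {T w r : List α} {a : α} (hwa : w ++ [a] <:+: T)
    (h : IsLongest (classL T (w ++ [a])) (w ++ r)) : NextRightMaximal T w r := by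
  have hbeg : begPos T (w ++ r) = begPos T (w ++ [a]) := h.1
  have hmax : RightMaximal T (w ++ r) := isLRep_iff.1 ⟨_, hwa, h⟩
  obtain ⟨i, hi⟩ := begPos_nonempty.2 hmax.1
  obtain ⟨r, rfl⟩ : [a] <+: r :=
    (List.prefix_append_right_inj w).1 (prefix_of_mem_begPos hi (hbeg ▸ hi) (h.2 _ rfl))
  refine ⟨by simp, hmax, fun p hp hpr hm => hpr.eq_of_length_le ?_⟩
  have hap : [a] <+: p :=
    List.prefix_of_prefix_length_le (List.prefix_append _ _) hpr (List.length_pos_iff.2 hp)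
  have hclass : begPos T (w ++ ([a] ++ r)) = begPos T (w ++ p) :=
    (begPos_anti ((List.prefix_append_right_inj w).2 hpr)).antisymm
      (hbeg ▸ begPos_anti ((List.prefix_append_right_inj w).2 hap))
  simpa using hm.isLongest.2 _ hclass

theorem NextRightMaximal.unique {T w r r' : List α} {c : α} (h : NextRightMaximal T w r)
    (h' : NextRightMaximal T w r') (hc : [c] <+: r) (hc' : [c] <+: r') : r = r' := by
  obtain ⟨r, rfl⟩ := hc
  obtain ⟨r', rfl⟩ := hc'
  obtain ⟨i, hi⟩ := begPos_nonempty.2 h.rightMaximal.1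
  have hi' : i ∈ begPos T (w ++ ([c] ++ r')) := h'.begPos_eq ▸ h.begPos_eq ▸ hi
  rcases List.prefix_or_prefix_of_prefix hi.2 hi'.2 with hp | hp
  · exact h'.eq_of_prefix _ h.ne_nil ((List.prefix_append_right_inj w).1 hp) h.rightMaximal
  · exact (h.eq_of_prefix _ h'.ne_nil ((List.prefix_append_right_inj w).1 hp)
      h'.rightMaximal).symm

theorem exists_nextRightMaximal {T w : List α} {c : α} (h : w ++ [c] <:+: T) :
    ∃ r, NextRightMaximal T w (c :: r) := by
  obtain ⟨p, q, hT⟩ := h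
  have hq : RightMaximal T (w ++ c :: q) := rightMaximal_of_suffix ⟨p, by simpa using hT⟩
  obtain ⟨r, -, hmax, hmin⟩ := exists_minimal_prefix (P := fun r => RightMaximal T (w ++ c :: r)) hq
  refine ⟨r, List.cons_ne_nil c r, hmax, fun p hp hpr hm => ?_⟩
  rcases List.prefix_cons_iff.1 hpr with rfl | ⟨p, rfl, hpr'⟩
  · exact absurd rfl hp
  · rw [hmin p hpr' hm]

theorem isCEdge_iff {T : List α} {c c' : Set (List α)} {x : List α} :
    IsCEdge T c x c' ↔ ∃ y, RightMaximal T y ∧ c = classR T y ∧ NextRightMaximal T y x ∧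
      c' = classR T (y ++ x) := by
  constructor
  · rintro ⟨y, a, hy, hc, hya, hlong, hc'⟩
    exact ⟨y, isLRep_iff.1 hy, hc, nextRightMaximal_of_isLongest hya hlong, hc'⟩
  · rintro ⟨y, hy, hc, hx, hc'⟩
    obtain ⟨a, r, rfl⟩ := List.exists_cons_of_ne_nil hx.ne_nil
    have hya : y ++ [a] <:+: T := infix_of_append (y := r) (by simpa using hx.rightMaximal.1)
    exact ⟨y, a, isLRep_iff.2 hy, hc, hya, hx.isLongest, hc'⟩

theorem exists_noRightMaximalAlong (T w : List α) :
    ∃ z o, w = z ++ o ∧ RightMaximal T z ∧ NoRightMaximalAlong T z o := by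
  induction w using List.reverseRecOn with
  | nil => exact ⟨[], [], rfl, rightMaximal_nil T, noRightMaximalAlong_nil T []⟩
  | append_singleton w c ih =>
    by_cases hm : RightMaximal T (w ++ [c])
    · exact ⟨_, [], (List.append_nil _).symm, hm, noRightMaximalAlong_nil T _⟩
    · obtain ⟨z, o, rfl, hz, ho⟩ := ih
      exact ⟨z, o ++ [c], List.append_assoc _ _ _, hz, ho.append (noRightMaximalAlong_singleton hm)⟩

theorem RightMaximal.spells {T z : List α} (h : RightMaximal T z) : Spells T (classR T z) z := by
  induction hn : z.length using Nat.strong_induction_on generalizing z with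
  | _ n ih =>
    subst hn
    rcases List.eq_nil_or_concat z with rfl | ⟨w, c, rfl⟩
    · exact .source
    · rw [List.concat_eq_append] at h ih ⊢
      obtain ⟨y, o, rfl, hy, ho⟩ := exists_noRightMaximalAlong T w
      have hc : NextRightMaximal T (y ++ o) [c] := ⟨List.cons_ne_nil c [], h, fun p hp hpc =>
        fun _ => hpc.eq_of_length_le (List.length_pos_iff.2 hp)⟩
      have hlt : y.length < (y ++ o ++ [c]).length := by simp
      have hstep := Spells.step (ih _ hlt hy rfl)
        (isCEdge_iff.2 ⟨y, hy, rfl, nextRightMaximal_append ho hc, rfl⟩)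
      rwa [← List.append_assoc] at hstep

theorem spells_iff {T : List α} {c : Set (List α)} {z : List α} :
    Spells T c z ↔ RightMaximal T z ∧ c = classR T z := by
  refine ⟨fun h => ?_, fun ⟨hz, hc⟩ => hc ▸ hz.spells⟩
  induction h with
  | source => exact ⟨rightMaximal_nil T, rfl⟩
  | step _ he ih =>
    obtain ⟨-, hzc⟩ := ih
    obtain ⟨y, -, hyc, hx, rfl⟩ := isCEdge_iff.1 he
    have hyz := classR_eq_classR.1 (hyc.symm.trans hzc)
    exact ⟨(hx.congr hyz).rightMaximal, classR_eq_classR.2 (endPos_append_congr hyz _)⟩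

/-! ### Loci -/

/-- The position `v` is the locus of the substring `w`: the point of the CDAWG reached by reading
`w` from the source. -/
structure IsLocus (T : List α) (v : Pos α) (w : List α) : Prop where
  isInfix : w <:+: T
  exists_base : ∃ z, RightMaximal T z ∧ v.base = classR T z ∧ w = z ++ v.off ∧
    NoRightMaximalAlong T z v.off

theorem IsLocus.endPos_eq {T w w' : List α} {v : Pos α} (h : IsLocus T v w)
    (h' : IsLocus T v w') : endPos T w = endPos T w' := by
  obtain ⟨z, -, hb, rfl, -⟩ := h.exists_base
  obtain ⟨z', -, hb', rfl, -⟩ := h'.exists_base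
  exact endPos_append_congr (classR_eq_classR.1 (hb.symm.trans hb')) _

theorem IsLocus.unique {T w : List α} {v v' : Pos α} (h : IsLocus T v w)
    (h' : IsLocus T v' w) : v = v' := by
  obtain ⟨z, hz, hb, hw, ho⟩ := h.exists_base
  obtain ⟨z', hz', hb', hw', ho'⟩ := h'.exists_base
  have eq_of_prefix {x y o : List α} (hy : RightMaximal T y) (hxo : NoRightMaximalAlong T x o)
      (hxy : x <+: y) (hyo : y <+: x ++ o) : x = y := by
    obtain ⟨p, rfl⟩ := hxy
    by_contra hne
    exact hxo p (by simpa using hne) ((List.prefix_append_right_inj x).1 hyo) hy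
  have hzw : z <+: w := ⟨_, hw.symm⟩
  have hzw' : z' <+: w := ⟨_, hw'.symm⟩
  obtain rfl : z = z' := by
    rcases List.prefix_or_prefix_of_prefix hzw hzw' with hp | hp
    · exact eq_of_prefix hz' ho hp (hw ▸ hzw')
    · exact (eq_of_prefix hz ho' hp (hw' ▸ hzw)).symm
  exact Pos.ext (hb.trans hb'.symm) (List.append_cancel_left (hw.symm.trans hw'))

theorem RightMaximal.isLocus {T z : List α} (h : RightMaximal T z) :
    IsLocus T ⟨classR T z, []⟩ z :=
  ⟨h.1, z, h, rfl, (List.append_nil z).symm, noRightMaximalAlong_nil T z⟩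

theorem IsLocus.append {T w p : List α} {v : Pos α} (h : IsLocus T v w) (hp : w ++ p <:+: T)
    (hmin : NoRightMaximalAlong T w p) : IsLocus T ⟨v.base, v.off ++ p⟩ (w ++ p) := by
  obtain ⟨z, hz, hb, rfl, ho⟩ := h.exists_base
  exact ⟨hp, z, hz, hb, List.append_assoc _ _ _, ho.append hmin⟩

theorem IsLocus.rightMaximal_iff {T w : List α} {v : Pos α} (h : IsLocus T v w) :
    RightMaximal T w ↔ v.off = [] := by
  obtain ⟨z, hz, -, rfl, ho⟩ := h.exists_base
  refine ⟨fun hm => ?_, fun h => by rwa [h, List.append_nil]⟩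
  by_contra hne
  exact ho _ hne List.prefix_rfl hm

theorem IsLocus.isCEdge_append_iff {T w r : List α} {v : Pos α} {c' : Set (List α)}
    (hw : IsLocus T v w) (hr : r ≠ []) :
    IsCEdge T v.base (v.off ++ r) c' ↔ NextRightMaximal T w r ∧ c' = classR T (w ++ r) := by
  obtain ⟨z, hz, hb, rfl, ho⟩ := hw.exists_base
  rw [isCEdge_iff, List.append_assoc]
  constructor
  · rintro ⟨y, -, hyb, hy, rfl⟩
    have hyz : endPos T y = endPos T z := classR_eq_classR.1 (hyb.symm.trans hb)
    exact ⟨(hy.congr hyz).of_append hr, classR_eq_classR.2 (endPos_append_congr hyz _)⟩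
  · rintro ⟨hnext, rfl⟩
    exact ⟨z, hz, hb, nextRightMaximal_append ho hnext, rfl⟩

theorem isType1_iff {T : List α} {v : Pos α} :
    IsType1 T v ↔ ∃ z, RightMaximal T z ∧ v = ⟨classR T z, []⟩ := by
  constructor
  · rintro ⟨⟨y, hy, hb⟩, ho⟩
    exact ⟨y, isLRep_iff.1 hy, Pos.ext hb ho⟩
  · rintro ⟨z, hz, rfl⟩
    exact ⟨⟨z, isLRep_iff.2 hz, rfl⟩, rfl⟩

theorem RightMaximal.isType1 {T z : List α} (h : RightMaximal T z) :
    IsType1 T ⟨classR T z, []⟩ :=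
  isType1_iff.2 ⟨z, h, rfl⟩

/-- `u` is the value of a type-1 node, that is, the longest string of that node. -/
def IsValue (T u : List α) : Prop := RightMaximal T u ∧ IsLongest (classR T u) u

theorem isValue_iff {T u : List α} : (∃ c, IsCNode T c ∧ IsLongest c u) ↔ IsValue T u := by
  constructor
  · rintro ⟨_, ⟨y, hy, rfl⟩, hu⟩
    have hclass : classR T u = classR T y := classR_eq_classR.2 hu.1
    exact ⟨(rightMaximal_congr hu.1).2 (isLRep_iff.1 hy), hclass ▸ hu⟩
  · rintro ⟨hu, hlong⟩
    exact ⟨_, ⟨u, isLRep_iff.2 hu, rfl⟩, hlong⟩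

theorem isType2For_iff {T : List α} {v : Pos α} {a : α} {u : List α} :
    IsType2For T v a u ↔ IsValue T u ∧ ¬ RightMaximal T (a :: u) ∧ IsLocus T v (a :: u) := by
  constructor
  · rintro ⟨hu, hau, ⟨z, hz, hauz⟩, hne, x, c', hx, hpre, hnex⟩
    obtain ⟨hzm, hb⟩ := spells_iff.1 hz
    obtain ⟨y, -, hyb, hnext, -⟩ := isCEdge_iff.1 hx
    have hzx : NextRightMaximal T z x := hnext.congr (classR_eq_classR.1 (hyb.symm.trans hb))
    have hloc : IsLocus T v (a :: u) :=
      ⟨hau, z, hzm, hb, hauz, hzx.noRightMaximalAlong hpre hnex⟩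
    exact ⟨isValue_iff.1 hu, fun h => hne (hloc.rightMaximal_iff.1 h), hloc⟩
  · rintro ⟨hu, hm, hloc⟩
    obtain ⟨z, hz, hb, hauz, -⟩ := hloc.exists_base
    obtain ⟨c, hc⟩ := exists_followedBy hloc.isInfix hm
    obtain ⟨r, hr⟩ := exists_nextRightMaximal (hc.append_infix hloc.isInfix)
    exact ⟨isValue_iff.2 hu, hloc.isInfix, ⟨z, hb ▸ hz.spells, hauz⟩,
      fun h => hm (hloc.rightMaximal_iff.2 h), v.off ++ c :: r, _,
      (hloc.isCEdge_append_iff hr.ne_nil).2 ⟨hr, rfl⟩, List.prefix_append _ _, by simp⟩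

theorem IsType2.off_ne_nil {T : List α} {v : Pos α} : IsType2 T v → v.off ≠ [] :=
  fun ⟨_, _, h⟩ => h.2.2.2.1

theorem IsType1.not_isType2 {T : List α} {v : Pos α} (h : IsType1 T v) : ¬ IsType2 T v :=
  fun h2 => h2.off_ne_nil h.2

theorem IsNode.exists_isLocus {T : List α} {v : Pos α} (h : IsNode T v) : ∃ w, IsLocus T v w := by
  rcases h with h | ⟨a, u, h⟩
  · obtain ⟨z, hz, rfl⟩ := isType1_iff.1 h
    exact ⟨z, hz.isLocus⟩
  · exact ⟨_, (isType2For_iff.1 h).2.2⟩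

theorem IsNode.isType1_iff_rightMaximal {T w : List α} {v : Pos α} (h : IsNode T v)
    (hw : IsLocus T v w) : IsType1 T v ↔ RightMaximal T w := by
  rw [hw.rightMaximal_iff]
  exact ⟨fun h1 => h1.2, fun ho => h.resolve_right fun h2 => h2.off_ne_nil ho⟩

/-! ### Edges and paths -/

theorem IsEdge.exists_first {T : List α} {e : Edge α} (he : IsEdge T e) : ∃ c, [c] <+: e.lab := by
  obtain ⟨c, r, hc⟩ := List.exists_cons_of_ne_nil he.2.2.1
  exact ⟨c, r, hc.symm⟩

theorem IsEdge.exists_nextRightMaximal {T w : List α} {e : Edge α} (he : IsEdge T e)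
    (hw : IsLocus T e.hi w) : ∃ r, NextRightMaximal T w r ∧
      (e.lab = r ∧ e.lo = ⟨classR T (w ++ r), []⟩ ∨
        e.lab <+: r ∧ e.lab ≠ r ∧ e.lo = ⟨e.hi.base, e.hi.off ++ e.lab⟩) := by
  obtain ⟨-, -, hne, ⟨x, c', hx, ⟨rfl, hlo⟩ | ⟨⟨s, rfl⟩, hs, hlo⟩⟩, -⟩ := he
  · obtain ⟨hr, rfl⟩ := (hw.isCEdge_append_iff hne).1 hx
    exact ⟨_, hr, .inl ⟨rfl, hlo⟩⟩
  · rw [List.append_assoc] at hx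
    obtain ⟨hr, -⟩ :=
      (hw.isCEdge_append_iff (List.append_ne_nil_of_left_ne_nil hne s)).1 hx
    exact ⟨_, hr, .inr ⟨List.prefix_append _ _, by simpa using hs, hlo⟩⟩

theorem IsEdge.lab_prefix {T w r : List α} {e : Edge α} {c : α} (he : IsEdge T e)
    (hw : IsLocus T e.hi w) (hr : NextRightMaximal T w r) (hc : [c] <+: e.lab)
    (hcr : [c] <+: r) : e.lab <+: r := by
  obtain ⟨r', hr', hlab⟩ := he.exists_nextRightMaximal hw
  have hpre : e.lab <+: r' := hlab.elim (fun h => h.1 ▸ List.prefix_rfl) (fun h => h.1)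
  rwa [hr.unique hr' hcr (hc.trans hpre)]

theorem IsEdge.isLocus_lo {T w : List α} {e : Edge α} (he : IsEdge T e)
    (hw : IsLocus T e.hi w) : IsLocus T e.lo (w ++ e.lab) := by
  obtain ⟨r, hr, ⟨rfl, hlo⟩ | ⟨hpre, hne, hlo⟩⟩ := he.exists_nextRightMaximal hw
  · exact hlo ▸ hr.rightMaximal.isLocus
  · refine hlo ▸ hw.append ?_ (hr.noRightMaximalAlong hpre hne)
    exact ((List.prefix_append_right_inj w).2 hpre).isInfix.trans hr.rightMaximal.1

theorem IsEdge.isType1_lo_iff {T w : List α} {e : Edge α} (he : IsEdge T e)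
    (hw : IsLocus T e.hi w) : IsType1 T e.lo ↔ RightMaximal T (w ++ e.lab) :=
  he.2.1.isType1_iff_rightMaximal (he.isLocus_lo hw)

theorem IsEdge.infix_first {T w : List α} {e : Edge α} {c : α} (he : IsEdge T e)
    (hw : IsLocus T e.hi w) (hc : [c] <+: e.lab) : w ++ [c] <:+: T :=
  ((List.prefix_append_right_inj w).2 hc).isInfix.trans (he.isLocus_lo hw).isInfix

theorem IsEdge.eq_of_prefix {T w p : List α} {e : Edge α} (he : IsEdge T e)
    (hw : IsLocus T e.hi w) (hp : p ≠ []) (hpe : p <+: e.lab) (hm : RightMaximal T (w ++ p)) :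
    p = e.lab := by
  obtain ⟨r, hr, ⟨rfl, -⟩ | ⟨hpre, hne, -⟩⟩ := he.exists_nextRightMaximal hw
  · exact hr.eq_of_prefix p hp hpe hm
  · exact absurd hm (hr.noRightMaximalAlong hpre hne p hp hpe)

theorem IsEdge.lab_eq_of_prefix {T : List α} {e e' : Edge α} (he : IsEdge T e)
    (he' : IsEdge T e') (hhi : e.hi = e'.hi) (h : e.lab <+: e'.lab) : e.lab = e'.lab := by
  by_contra hne
  obtain ⟨w, hw⟩ := he.1.exists_isLocus
  obtain ⟨r, hr, ⟨rfl, -⟩ | ⟨-, -, hlo⟩⟩ := he.exists_nextRightMaximal hw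
  · exact hne (he'.eq_of_prefix (hhi ▸ hw) he.2.2.1 h hr.rightMaximal)
  · exact he'.2.2.2.2 e.lab he.2.2.1 h hne (hhi ▸ hlo ▸ he.2.1)

theorem IsEdge.unique {T : List α} {e e' : Edge α} {c : α} (he : IsEdge T e)
    (he' : IsEdge T e') (hhi : e.hi = e'.hi) (hc : [c] <+: e.lab) (hc' : [c] <+: e'.lab) :
    e = e' := by
  obtain ⟨w, hw⟩ := he.1.exists_isLocus
  have hw' : IsLocus T e'.hi w := hhi ▸ hw
  obtain ⟨r, hr⟩ := LCDAWG.exists_nextRightMaximal (he.infix_first hw hc)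
  have hcr : [c] <+: c :: r := List.prefix_append [c] r
  have hlab : e.lab = e'.lab := by
    rcases List.prefix_or_prefix_of_prefix (he.lab_prefix hw hr hc hcr)
      (he'.lab_prefix hw' hr hc' hcr) with h | h
    · exact he.lab_eq_of_prefix he' hhi h
    · exact (he'.lab_eq_of_prefix he hhi.symm h).symm
  exact Edge.ext hhi hlab ((he.isLocus_lo hw).unique (hlab ▸ he'.isLocus_lo hw'))

theorem exists_edge {T w : List α} {v : Pos α} {c : α} (hv : IsNode T v) (hw : IsLocus T v w)
    (hc : w ++ [c] <:+: T) : ∃ e, IsEdge T e ∧ e.hi = v ∧ [c] <+: e.lab := by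
  obtain ⟨r, hr⟩ := exists_nextRightMaximal hc
  have hcedge : IsCEdge T v.base (v.off ++ c :: r) (classR T (w ++ c :: r)) :=
    (hw.isCEdge_append_iff hr.ne_nil).2 ⟨hr, rfl⟩
  obtain ⟨p, hpr, ⟨hp, hpcase⟩, hmin⟩ := exists_minimal_prefix (r := c :: r)
    (P := fun p => p ≠ [] ∧ (p = c :: r ∨ IsNode T ⟨v.base, v.off ++ p⟩))
    ⟨hr.ne_nil, .inl rfl⟩
  have hinterior : ∀ q : List α, q ≠ [] → q <+: p → q ≠ p →
      ¬ IsNode T ⟨v.base, v.off ++ q⟩ :=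
    fun q hq hqp hqne hn => hqne (hmin q hqp ⟨hq, .inr hn⟩)
  have hfirst : [c] <+: p := List.prefix_of_prefix_length_le (List.prefix_append [c] r) hpr
    (List.length_pos_iff.2 hp)
  by_cases hpr' : p = c :: r
  · subst hpr'
    exact ⟨⟨v, c :: r, ⟨_, []⟩⟩, ⟨hv, .inl hr.rightMaximal.isType1, hp,
      ⟨_, _, hcedge, .inl ⟨rfl, rfl⟩⟩, hinterior⟩, rfl, hfirst⟩
  · exact ⟨⟨v, p, ⟨v.base, v.off ++ p⟩⟩, ⟨hv, hpcase.resolve_left hpr', hp, ⟨_, _, hcedge,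
      .inr ⟨(List.prefix_append_right_inj _).2 hpr, by simpa using hpr', rfl⟩⟩, hinterior⟩, rfl,
      hfirst⟩

theorem IsType2.edge_unique {T : List α} {v : Pos α} {e e' : Edge α} (hv : IsType2 T v)
    (he : IsEdge T e) (he' : IsEdge T e') (h : e.hi = v) (h' : e'.hi = v) : e = e' := by
  subst h
  obtain ⟨a, u, ha⟩ := hv
  obtain ⟨-, hm, hloc⟩ := isType2For_iff.1 ha
  obtain ⟨c, hc⟩ := he.exists_first
  obtain ⟨c', hc'⟩ := he'.exists_first
  obtain rfl := eq_of_not_rightMaximal hm (he.infix_first hloc hc)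
    (he'.infix_first (h' ▸ hloc) hc')
  exact he.unique he' h'.symm hc hc'

theorem IsType2.exists_edge {T : List α} {v : Pos α} (hv : IsType2 T v) :
    ∃ e, IsEdge T e ∧ e.hi = v := by
  obtain ⟨a, u, ha⟩ := id hv
  obtain ⟨-, hm, hloc⟩ := isType2For_iff.1 ha
  obtain ⟨c, hc⟩ := exists_followedBy hloc.isInfix hm
  obtain ⟨e, he, hhi, -⟩ := LCDAWG.exists_edge (.inr hv) hloc (hc.append_infix hloc.isInfix)
  exact ⟨e, he, hhi⟩

theorem pathLab_cons (e : Edge α) (p : List (Edge α)) : pathLab (e :: p) = e.lab ++ pathLab p :=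
  List.flatMap_cons

theorem IsPath.unique {T : List α} {v w w' : Pos α} {p p' : List (Edge α)} (h : IsPath T v p w)
    (h' : IsPath T v p' w') (hlab : pathLab p = pathLab p') : p = p' := by
  induction p generalizing v p' with
  | nil =>
    cases p' with
    | nil => rfl
    | cons e' p' =>
      exact absurd (List.append_eq_nil_iff.1 (hlab.symm.trans rfl)).1 h'.1.2.2.1
  | cons e p ih =>
    cases p' with
    | nil => exact absurd (List.append_eq_nil_iff.1 (hlab.trans rfl)).1 h.1.2.2.1
    | cons e' p' =>
      rw [pathLab_cons, pathLab_cons] at hlab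
      obtain ⟨c, hc⟩ := h.1.exists_first
      have hc' : [c] <+: e'.lab := List.prefix_of_prefix_length_le
        (hlab ▸ hc.trans (List.prefix_append _ _)) (List.prefix_append _ _)
        (List.length_pos_iff.2 h'.1.2.2.1)
      obtain rfl := h.1.unique h'.1 (h.2.1.trans h'.2.1.symm) hc hc'
      rw [ih h.2.2 h'.2.2 (List.append_cancel_left hlab)]

/-- `p` is a path from `v` to a type-1 node all of whose interior nodes have type 2: the pieces of
a single edge of the CDAWG from `v` on. -/
inductive PieceChain (T : List α) : Pos α → List (Edge α) → Prop
  | single {e : Edge α} : IsEdge T e → IsType1 T e.lo → PieceChain T e.hi [e]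
  | cons {e : Edge α} {p : List (Edge α)} :
      IsEdge T e → IsType2 T e.lo → PieceChain T e.lo p → PieceChain T e.hi (e :: p)

theorem PieceChain.exists_isPath {T : List α} {v : Pos α} {p : List (Edge α)}
    (h : PieceChain T v p) : ∃ w, IsPath T v p w := by
  induction h with
  | single he _ => exact ⟨_, he, rfl, rfl⟩
  | cons he _ _ ih => exact ih.imp fun _ hp => ⟨he, rfl, hp⟩

theorem PieceChain.exists_eq_cons {T : List α} {v : Pos α} {p : List (Edge α)}
    (h : PieceChain T v p) : ∃ e q, p = e :: q ∧ IsEdge T e ∧ e.hi = v := by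
  cases h with
  | single he _ => exact ⟨_, _, rfl, he, rfl⟩
  | cons he _ _ => exact ⟨_, _, rfl, he, rfl⟩

theorem exists_pieceChain {T w r : List α} {v : Pos α} (hv : IsNode T v) (hw : IsLocus T v w)
    (hr : NextRightMaximal T w r) : ∃ p, PieceChain T v p ∧ pathLab p = r := by
  induction hn : r.length using Nat.strong_induction_on generalizing v w r with
  | _ n ih =>
    subst hn
    obtain ⟨c, r₀, hcr⟩ := List.exists_cons_of_ne_nil hr.ne_nil
    have hcr : [c] <+: r := ⟨r₀, hcr.symm⟩
    obtain ⟨e, he, rfl, hc⟩ := exists_edge hv hw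
      (((List.prefix_append_right_inj w).2 hcr).isInfix.trans hr.rightMaximal.1)
    obtain ⟨r', rfl⟩ := he.lab_prefix hw hr hc hcr
    rcases eq_or_ne r' [] with rfl | hr'
    · have hm : RightMaximal T (w ++ e.lab) := by simpa only [List.append_nil] using hr.rightMaximal
      exact ⟨[e], .single he ((he.isType1_lo_iff hw).2 hm), pathLab_cons e []⟩
    · have h2 : IsType2 T e.lo := he.2.1.resolve_left fun h1 => by
        have := hr.eq_of_prefix _ he.2.2.1 (List.prefix_append _ _) ((he.isType1_lo_iff hw).1 h1)
        exact hr' (by simpa using this)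
      have hlen : r'.length < (e.lab ++ r').length := by
        simpa [List.length_pos_iff] using he.2.2.1
      obtain ⟨p, hp, hlab⟩ := ih _ hlen he.2.1 (he.isLocus_lo hw) (hr.of_append hr') rfl
      exact ⟨e :: p, .cons he h2 hp, by rw [pathLab_cons, hlab]⟩

/-! ### Suffix links -/

/-- `a :: s` is the shortest string whose locus is `v`, and `s` is right-maximal: then `s` is the
string read at the suffix link of `v`. -/
structure IsShortestAt (T : List α) (v : Pos α) (a : α) (s : List α) : Prop where
  isLocus : IsLocus T v (a :: s)
  rightMaximal : RightMaximal T s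
  endPos_ne : endPos T (a :: s) ≠ endPos T s

theorem IsShortestAt.suffix {T s w : List α} {v : Pos α} {a : α} (h : IsShortestAt T v a s)
    (hw : IsLocus T v w) : a :: s <:+ w := by
  have hends := h.isLocus.endPos_eq hw
  obtain ⟨j, hj⟩ := endPos_nonempty.2 hw.isInfix
  rcases List.suffix_or_suffix_of_suffix (hends ▸ hj : j ∈ endPos T (a :: s)).2 hj.2 with hs | hs
  · exact hs
  · rcases List.suffix_cons_iff.1 hs with rfl | hs
    · exact List.suffix_rfl
    · exact absurd ((endPos_anti (List.suffix_cons a s)).antisymm (hends ▸ endPos_anti hs))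
        h.endPos_ne

theorem IsShortestAt.unique {T s s' : List α} {v : Pos α} {a b : α} (h : IsShortestAt T v a s)
    (h' : IsShortestAt T v b s') : s = s' :=
  have hs := h.suffix h'.isLocus
  (List.cons.inj (hs.eq_of_length_le (h'.suffix h.isLocus).length_le)).2

theorem IsType1.exists_isShortestAt {T x s : List α} {v : Pos α} (h : IsType1 T v)
    (hx : IsLongest v.base x) (hs : IsLongest {y | y <:+ x ∧ y ∉ v.base} s) :
    ∃ a, IsShortestAt T v a s := by
  obtain ⟨⟨⟨t, rfl⟩, hsv⟩, hsmax⟩ := hs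
  have ht : t ≠ [] := by
    rintro rfl
    exact hsv hx.1
  obtain ⟨t, a, rfl⟩ := (List.eq_nil_or_concat' t).resolve_left ht
  have hsuf : a :: s <:+ t ++ [a] ++ s := ⟨t, by simp⟩
  have hmem : a :: s ∈ v.base := by
    by_contra hns
    simpa using hsmax (a :: s) ⟨hsuf, hns⟩
  obtain ⟨z, hz, rfl⟩ := isType1_iff.1 h
  have hends : endPos T (a :: s) = endPos T z := hmem
  have hm : RightMaximal T (a :: s) := (rightMaximal_congr hends).2 hz
  exact ⟨a, classR_eq_classR.2 hends ▸ hm.isLocus, hm.of_suffix (List.suffix_cons a s),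
    fun h => hsv (h.symm.trans hends)⟩

theorem IsType2For.isShortestAt {T u : List α} {v : Pos α} {a : α} (h : IsType2For T v a u) :
    IsShortestAt T v a u :=
  have ⟨hu, hm, hloc⟩ := isType2For_iff.1 h
  ⟨hloc, hu.1, fun h => hm ((rightMaximal_congr h).2 hu.1)⟩

theorem IsSlink.exists_isShortestAt {T : List α} {v x : Pos α} (h : IsSlink T v x) :
    ∃ a s, IsShortestAt T v a s ∧ x = ⟨classR T s, []⟩ := by
  rcases h with ⟨h1, y, hy, s, hs, rfl⟩ | ⟨a, u, h, rfl⟩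
  · obtain ⟨a, ha⟩ := h1.exists_isShortestAt hy hs
    exact ⟨a, s, ha, rfl⟩
  · exact ⟨a, u, h.isShortestAt, rfl⟩

theorem IsSlink.unique {T : List α} {v x x' : Pos α} (h : IsSlink T v x) (h' : IsSlink T v x') :
    x = x' := by
  obtain ⟨a, s, hs, rfl⟩ := h.exists_isShortestAt
  obtain ⟨b, s', hs', rfl⟩ := h'.exists_isShortestAt
  rw [hs.unique hs']

theorem IsLocus.acc_isSlink {T w : List α} {v : Pos α} (hw : IsLocus T v w) :
    Acc (fun x v => IsSlink T v x) v := by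
  induction hn : w.length using Nat.strong_induction_on generalizing v w with
  | _ n ih =>
    subst hn
    refine Acc.intro v fun x hx => ?_
    obtain ⟨a, s, hs, rfl⟩ := hx.exists_isShortestAt
    exact ih s.length (hs.suffix hw).length_le hs.rightMaximal.isLocus rfl

theorem wellFounded_isSlink (T : List α) : WellFounded (fun x v => IsSlink T v x) :=
  ⟨fun v => Acc.intro v fun _ hx =>
    have ⟨_, _, hs, hxs⟩ := hx.exists_isShortestAt
    hxs ▸ hs.rightMaximal.isLocus.acc_isSlink⟩

theorem exists_isLongest_classR {T y : List α} (h : y <:+: T) :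
    ∃ x, IsLongest (classR T y) x := by
  refine exists_isLongest ⟨y, rfl⟩ ⟨T.length, ?_⟩
  rintro _ ⟨x, hx, rfl⟩
  exact ((infix_congr hx).2 h).length_le

theorem exists_isSlink {T : List α} {v : Pos α} (hv : IsNode T v) (hne : v ≠ ⟨classR T [], []⟩) :
    ∃ x, IsSlink T v x := by
  rcases hv with h1 | ⟨a, u, h⟩
  · obtain ⟨z, hz, rfl⟩ := isType1_iff.1 h1
    obtain ⟨x, hx⟩ := exists_isLongest_classR hz.1
    have hnil : [] ∉ classR T z := fun h => hne (by rw [← classR_eq_classR.2 h])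
    obtain ⟨s, hs⟩ := exists_isLongest (S := {y | y <:+ x ∧ y ∉ classR T z})
      ⟨[], List.nil_suffix, hnil⟩
      ⟨x.length, by rintro _ ⟨y, hy, rfl⟩; exact hy.1.length_le⟩
    exact ⟨_, .inl ⟨h1, x, hx, s, hs, rfl⟩⟩
  · exact ⟨_, .inr ⟨a, u, h, rfl⟩⟩

theorem isValue_nil (T : List α) : IsValue T [] := by
  refine ⟨rightMaximal_nil T, rfl, fun z (hz : endPos T z = endPos T []) => ?_⟩
  have h0 : 0 ∈ endPos T [] := ⟨Nat.zero_le _, List.nil_suffix⟩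
  exact length_le_of_mem_endPos (hz ▸ h0)

theorem RightMaximal.isValue {T s : List α} {a : α} (hs : RightMaximal T s) (has : a :: s <:+: T)
    (hne : endPos T (a :: s) ≠ endPos T s) : IsValue T s := by
  refine ⟨hs, rfl, fun y (hy : endPos T y = endPos T s) => ?_⟩
  by_contra! hlt
  obtain ⟨j, hj⟩ := endPos_nonempty.2 has
  have hsub := endPos_anti (T := T) (List.suffix_cons a s)
  have hsuf : a :: s <:+ y := suffix_of_mem_endPos (hy ▸ hsub hj) hj hlt
  exact hne (hsub.antisymm (hy ▸ endPos_anti hsuf))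

theorem IsEdge.not_isValue {T w p u : List α} {e : Edge α} {a : α} (he : IsEdge T e)
    (hw : IsLocus T e.hi w) (hp : p ≠ []) (hpe : p <+: e.lab) (hne : p ≠ e.lab)
    (hau : w ++ p = a :: u) : ¬ IsValue T u := by
  intro hu
  have hnone : NoRightMaximalAlong T w p := fun q hq hqp hm =>
    hne (hpe.eq_of_length_le (he.eq_of_prefix hw hq (hqp.trans hpe) hm ▸ hqp.length_le))
  have hwp : w ++ p <:+: T :=
    ((List.prefix_append_right_inj w).2 hpe).isInfix.trans (he.isLocus_lo hw).isInfix
  have hloc := hw.append hwp hnone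
  have hm := hnone p hp List.prefix_rfl
  rw [hau] at hloc hm
  exact he.2.2.2.2 p hp hpe hne (.inr ⟨a, u, isType2For_iff.2 ⟨hu, hm, hloc⟩⟩)

theorem IsEdge.slen_lt_two_of_hi_eq_source {T : List α} {e : Edge α} (he : IsEdge T e)
    (hs : e.hi = ⟨classR T [], []⟩) : e.slen < 2 := by
  by_contra! hlen
  obtain ⟨c, hc⟩ := he.exists_first
  refine he.not_isValue (hs ▸ (rightMaximal_nil T).isLocus) (List.cons_ne_nil c []) hc
    (fun h => ?_) rfl (isValue_nil T)
  rw [Edge.slen, ← h] at hlen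
  simp at hlen

theorem IsLocus.exists_eq_append {T w r : List α} {v : Pos α}
    (h : IsLocus T ⟨v.base, v.off ++ r⟩ w) : ∃ w', IsLocus T v w' ∧ w = w' ++ r := by
  obtain ⟨z, hz, hb, rfl, ho⟩ := h.exists_base
  have happ : z ++ (v.off ++ r) = z ++ v.off ++ r := (List.append_assoc _ _ _).symm
  exact ⟨z ++ v.off, ⟨infix_of_append (happ ▸ h.isInfix), z, hz, hb, rfl,
    ho.mono (List.prefix_append _ _)⟩, happ⟩

theorem IsEdge.rightMaximal_append_lab {T s : List α} {e : Edge α} {a : α} (he : IsEdge T e)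
    (h : IsShortestAt T e.hi a s) : RightMaximal T (s ++ e.lab) := by
  obtain ⟨r, hr, ⟨rfl, -⟩ | ⟨-, -, hlo⟩⟩ := he.exists_nextRightMaximal h.isLocus
  · exact hr.rightMaximal.of_suffix (List.suffix_cons a _)
  · have h2 : IsType2 T e.lo := he.2.1.resolve_left fun h1 => by
      have hoff : e.hi.off ++ e.lab = [] := (congrArg Pos.off hlo).symm.trans h1.2
      exact he.2.2.1 (List.append_eq_nil_iff.1 hoff).2
    obtain ⟨b, u, h2⟩ := h2
    obtain ⟨hu, hm, hloc⟩ := isType2For_iff.1 h2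
    obtain ⟨w, hw, hbu⟩ := (hlo ▸ hloc).exists_eq_append
    have hsuf : a :: (s ++ e.lab) <:+ b :: u := by
      obtain ⟨t, ht⟩ := h.suffix hw
      exact ⟨t, by rw [hbu, ← ht, List.append_assoc, List.cons_append]⟩
    rcases List.suffix_cons_iff.1 hsuf with heq | hsuf
    · exact (List.cons.inj heq).2 ▸ hu.1
    · exact absurd ((rightMaximal_congr ((he.isLocus_lo h.isLocus).endPos_eq hloc)).1
        (hu.1.of_suffix hsuf)) hm

/-- No right-maximal string is met strictly inside, since otherwise `L-CDAWG(T)` would have a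
type-2 node inside `e`. -/
theorem IsEdge.nextRightMaximal {T s : List α} {e : Edge α} {a : α} (he : IsEdge T e)
    (h : IsShortestAt T e.hi a s) : NextRightMaximal T s e.lab := by
  refine ⟨he.2.2.1, he.rightMaximal_append_lab h, fun p hp hpe hm => ?_⟩
  by_contra hne
  have hinf : a :: (s ++ p) <:+: T :=
    ((List.prefix_append_right_inj (a :: s)).2 hpe).isInfix.trans (he.isLocus_lo h.isLocus).isInfix
  refine he.not_isValue h.isLocus hp hpe hne rfl (hm.isValue hinf fun hends => hne ?_)
  exact he.eq_of_prefix h.isLocus hp hpe ((rightMaximal_congr hends).2 hm)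

/-! ### Jump links -/

theorem IsEdge.exists_esuf {T : List α} {e : Edge α} (he : IsEdge T e) (hlen : 2 ≤ e.slen) :
    ∃ v p, IsSlink T e.hi v ∧ PieceChain T v p ∧ IsESuf T e p := by
  obtain ⟨v, hv⟩ := exists_isSlink he.1 fun h => (he.slen_lt_two_of_hi_eq_source h).not_ge hlen
  obtain ⟨a, s, hs, rfl⟩ := hv.exists_isShortestAt
  obtain ⟨p, hp, hlab⟩ := exists_pieceChain (.inl hs.rightMaximal.isType1) hs.rightMaximal.isLocus
    (he.nextRightMaximal hs)
  obtain ⟨w, hw⟩ := hp.exists_isPath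
  exact ⟨_, p, hv, hp, _, w, hv, hw, hlab⟩

theorem IsESuf.unique {T : List α} {e : Edge α} {p p' : List (Edge α)} (h : IsESuf T e p)
    (h' : IsESuf T e p') : p = p' := by
  obtain ⟨v, w, hv, hp, hl⟩ := h
  obtain ⟨v', w', hv', hp', hl'⟩ := h'
  obtain rfl := hv.unique hv'
  exact hp.unique hp' (hl.trans hl'.symm)

theorem IsESuf.isSlink_head {T : List α} {e e₁ : Edge α} {p : List (Edge α)}
    (h : IsESuf T e (e₁ :: p)) : IsSlink T e.hi e₁.hi :=
  have ⟨_, _, hv, hp, _⟩ := h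
  hp.2.1 ▸ hv

theorem IsESuf.lab_head_prefix {T : List α} {e e₁ : Edge α} {p : List (Edge α)}
    (h : IsESuf T e (e₁ :: p)) : e₁.lab <+: e.lab :=
  have ⟨_, _, _, _, hl⟩ := h
  ⟨pathLab p, by rw [← hl, pathLab_cons]⟩

theorem IsESuf.lab_eq {T : List α} {e e₁ : Edge α} (h : IsESuf T e [e₁]) : e₁.lab = e.lab :=
  have ⟨_, _, _, _, hl⟩ := h
  (List.flatMap_singleton _ _).symm.trans hl

theorem IsJump.unique {T : List α} {e : Edge α} {p p' : List (Edge α)} (h : IsJump T e p)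
    (h' : IsJump T e p') : p = p' := by
  induction h with
  | single _ _ hs _ ih =>
    cases h' with
    | single _ _ hs' h' =>
      obtain rfl := List.singleton_inj.1 (hs.unique hs')
      exact ih h'
    | path _ _ hs' h' => exact absurd h' (by simp [← hs.unique hs'])
  | path _ _ hs hp =>
    cases h' with
    | single _ _ hs' h' => exact absurd hp (by simp [hs.unique hs'])
    | path _ _ hs' h' => exact hs.unique hs'

theorem IsEdge.exists_jump {T : List α} {e : Edge α} (he : IsEdge T e) (hlen : 2 ≤ e.slen) :
    ∃ p, IsJump T e p ∧ (∃ v w, IsPath T v p w) ∧ 2 ≤ p.length ∧ pathLab p = e.lab := by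
  induction hv : e.hi using (wellFounded_isSlink T).induction generalizing e with
  | _ v ih =>
    subst hv
    obtain ⟨_, p, -, hp, hs⟩ := he.exists_esuf hlen
    cases hp with
    | single he₁ _ =>
      have hlab := hs.lab_eq
      obtain ⟨p, hp, hpath, hpl, hplab⟩ :=
        ih _ hs.isSlink_head he₁ (by rwa [Edge.slen, hlab]) rfl
      exact ⟨p, .single he hlen hs hp, hpath, hpl, hplab.trans hlab⟩
    | @cons e₁ _ _ _ hp =>
      obtain ⟨e₂, q, rfl, -, -⟩ := hp.exists_eq_cons
      obtain ⟨v, w, -, hpath, hlab⟩ := id hs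
      have hpl : 2 ≤ (e₁ :: e₂ :: q).length := Nat.le_add_left 2 q.length
      exact ⟨_, .path he hlen hs hpl, ⟨v, w, hpath⟩, hpl, hlab⟩

/-! ### The number of edges -/

theorem occ_append_singleton_lt {T u : List α} (hu : RightMaximal T u) (a : α) :
    occ T (u ++ [a]) < occ T u :=
  Set.ncard_lt_ncard ((begPos_anti (List.prefix_append _ _)).ssubset_of_ne fun h =>
    hu.2 a (followedBy_iff.2 h)) (finite_begPos T u)

theorem occ_cons_lt {T u : List α} (hu : IsLongest (classR T u) u) (a : α) :
    occ T (a :: u) < occ T u := by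
  rw [occ_eq_ncard_endPos, occ_eq_ncard_endPos]
  refine Set.ncard_lt_ncard ((endPos_anti (List.suffix_cons a u)).ssubset_of_ne fun h => ?_)
    (finite_endPos T u)
  simpa using hu.2 (a :: u) h

theorem IsValue.isMaximalRepeat {T u : List α} (hu : IsValue T u)
    (h : (∃ a, u ++ [a] <:+: T) ∨ ∃ a, a :: u <:+: T) : IsMaximalRepeat T u := by
  have hpos {x : List α} (hx : x <:+: T) : 0 < occ T x :=
    (Set.ncard_pos (finite_begPos T _)).2 (begPos_nonempty.2 hx)
  refine ⟨?_, fun a _ => occ_append_singleton_lt hu.1 a, fun a _ => occ_cons_lt hu.2 a⟩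
  rcases h with ⟨a, ha⟩ | ⟨a, ha⟩
  · exact (Nat.succ_le_of_lt (hpos ha)).trans_lt (occ_append_singleton_lt hu.1 a)
  · exact (Nat.succ_le_of_lt (hpos ha)).trans_lt (occ_cons_lt hu.2 a)

theorem finite_infixes (T : List α) : {y | y <:+: T}.Finite :=
  (List.finite_toSet T.sublists).subset fun _ hy => List.mem_sublists.2 hy.sublist

theorem finite_rightExtensions (T : List α) : (rightExtensions T).Finite :=
  (finite_infixes T).subset fun _ ⟨_, _, _, _, h⟩ => h

theorem finite_leftExtensions (T : List α) : (leftExtensions T).Finite :=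
  (finite_infixes T).subset fun _ ⟨_, _, _, _, h⟩ => h

theorem IsEdge.exists_rightExtension {T : List α} {e : Edge α} (he : IsEdge T e)
    (h : IsType1 T e.hi) :
    ∃ u c, u ++ [c] ∈ rightExtensions T ∧ e.hi = ⟨classR T u, []⟩ ∧ [c] <+: e.lab := by
  obtain ⟨z, hz, hhi⟩ := isType1_iff.1 h
  obtain ⟨u, hu⟩ := exists_isLongest_classR hz.1
  have hends : endPos T u = endPos T z := hu.1
  have hm := (rightMaximal_congr hends).2 hz
  rw [← classR_eq_classR.2 hends] at hhi hu
  obtain ⟨c, hc⟩ := he.exists_first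
  have hinf := he.infix_first (hhi ▸ hm.isLocus) hc
  exact ⟨u, c, ⟨u, c, IsValue.isMaximalRepeat ⟨hm, hu⟩ (.inl ⟨c, hinf⟩), rfl, hinf⟩, hhi, hc⟩

theorem IsType2.exists_leftExtension {T : List α} {v : Pos α} (h : IsType2 T v) :
    ∃ y ∈ leftExtensions T, IsLocus T v y := by
  obtain ⟨a, u, h⟩ := h
  obtain ⟨hu, -, hloc⟩ := isType2For_iff.1 h
  exact ⟨_, ⟨u, a, hu.isMaximalRepeat (.inr ⟨a, hloc.isInfix⟩), rfl, hloc.isInfix⟩, hloc⟩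

theorem finite_and_ncard_le_of_injective_rel {β γ : Type*} [Nonempty γ] {s : Set β} {t : Set γ}
    (ht : t.Finite) {R : β → γ → Prop} (hex : ∀ x ∈ s, ∃ y ∈ t, R x y)
    (hinj : ∀ x ∈ s, ∀ x' ∈ s, ∀ y, R x y → R x' y → x = x') :
    s.Finite ∧ s.ncard ≤ t.ncard := by
  choose! f hft hfR using hex
  have hf : Set.InjOn f s := fun x hx x' hx' h => hinj x hx x' hx' _ (hfR x hx) (h ▸ hfR x' hx')
  exact ⟨.of_injOn hft hf ht, Set.ncard_le_ncard_of_injOn f hft hf ht⟩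

theorem finite_edges_and_ncard_le (T : List α) :
    {e | IsEdge T e}.Finite ∧ {e | IsEdge T e}.ncard ≤ numExtensions T := by
  obtain ⟨hfin₁, hle₁⟩ := finite_and_ncard_le_of_injective_rel (finite_rightExtensions T)
    (s := {e | IsEdge T e ∧ IsType1 T e.hi})
    (R := fun e y => ∃ u c, y = u ++ [c] ∧ e.hi = ⟨classR T u, []⟩ ∧ [c] <+: e.lab)
    (fun e ⟨he, h1⟩ =>
      have ⟨u, c, hy, hhi, hc⟩ := he.exists_rightExtension h1
      ⟨_, hy, u, c, rfl, hhi, hc⟩)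
    (by
      rintro e ⟨he, -⟩ e' ⟨he', -⟩ _ ⟨u, c, rfl, hhi, hc⟩ ⟨u', c', huc, hhi', hc'⟩
      obtain ⟨rfl, hcc⟩ := List.append_inj' huc rfl
      exact he.unique he' (hhi.trans hhi'.symm) hc (hcc ▸ hc'))
  obtain ⟨hfin₂, hle₂⟩ := finite_and_ncard_le_of_injective_rel (finite_leftExtensions T)
    (s := {e | IsEdge T e ∧ IsType2 T e.hi}) (R := fun e y => IsLocus T e.hi y)
    (fun _ ⟨_, h2⟩ => h2.exists_leftExtension)
    (fun _ ⟨he, h2⟩ _ ⟨he', _⟩ _ hy hy' => h2.edge_unique he he' rfl (hy'.unique hy))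
  have hunion : {e | IsEdge T e} =
      {e | IsEdge T e ∧ IsType1 T e.hi} ∪ {e | IsEdge T e ∧ IsType2 T e.hi} := by
    ext e
    exact ⟨fun he => he.1.imp (⟨he, ·⟩) (⟨he, ·⟩), fun h => h.elim And.left And.left⟩
  rw [hunion]
  exact ⟨hfin₁.union hfin₂, (Set.ncard_union_le _ _).trans (add_le_add hle₁ hle₂)⟩

theorem exists_isEdge_of_ne_nil {T : List α} (hT : T ≠ []) : ∃ e, IsEdge T e := by
  obtain ⟨c, r, rfl⟩ := List.exists_cons_of_ne_nil hT
  obtain ⟨e, he, -⟩ := exists_edge (.inl (rightMaximal_nil _).isType1) (rightMaximal_nil _).isLocus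
    (List.prefix_append [c] r).isInfix
  exact ⟨e, he⟩

/-! ### Weakest preconditions with running times -/

/-- Weakest precondition for total correctness with running time: started in `s`, provided this is
a word state, `p` halts in a word state `s'` after `t` time units, where `Q t s'`. -/
def WP (cmp : ℕ → ℕ → Prop) (w : ℕ) (p : Prog) (Q : ℕ → State → Prop) (s : State) : Prop :=
  s.IsWordState w → ∃ t s', Exec cmp w p s t s' ∧ s'.IsWordState w ∧ Q t s'

/-- The state after writing `n` to register `d`. -/
def State.setReg (s : State) (d n : ℕ) : State := ⟨Function.update s.reg d n, s.mem⟩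

/-- The state after writing `n` to the cell `i` of the array `k`. -/
def State.setMem (s : State) (k i n : ℕ) : State :=
  ⟨s.reg, Function.update s.mem k (Function.update (s.mem k) i n)⟩

@[simp]
theorem State.setReg_reg (s : State) (d n : ℕ) :
    (s.setReg d n).reg = Function.update s.reg d n := rfl

@[simp]
theorem State.setReg_mem (s : State) (d n : ℕ) : (s.setReg d n).mem = s.mem := rfl

@[simp]
theorem State.setMem_reg (s : State) (k i n : ℕ) : (s.setMem k i n).reg = s.reg := rfl

@[simp]
theorem State.setMem_mem (s : State) (k i n : ℕ) :
    (s.setMem k i n).mem = Function.update s.mem k (Function.update (s.mem k) i n) := rfl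

theorem State.IsWordState.setReg {w : ℕ} {s : State} (hs : s.IsWordState w) {n : ℕ}
    (hn : n < 2 ^ w) (d : ℕ) : (s.setReg d n).IsWordState w :=
  ⟨Function.forall_update_iff s.reg (fun _ v => v < 2 ^ w) |>.2 ⟨hn, fun r _ => hs.1 r⟩, hs.2⟩

theorem State.IsWordState.setMem {w : ℕ} {s : State} (hs : s.IsWordState w) {n : ℕ}
    (hn : n < 2 ^ w) (k i : ℕ) : (s.setMem k i n).IsWordState w :=
  ⟨hs.1, Function.forall_update_iff s.mem (fun _ f => ∀ j, f j < 2 ^ w) |>.2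
    ⟨Function.forall_update_iff (s.mem k) (fun _ v => v < 2 ^ w) |>.2 ⟨hn, fun j _ => hs.2 k j⟩,
      fun l _ => hs.2 l⟩⟩

section WP

variable {cmp : ℕ → ℕ → Prop} {w : ℕ} {Q : ℕ → State → Prop} {s : State}

theorem WP.mono {p : Prog} {Q' : ℕ → State → Prop} (h : WP cmp w p Q s)
    (hQ : ∀ t s', Q t s' → Q' t s') : WP cmp w p Q' s := fun hs =>
  let ⟨t, s', hexec, hs', hQs'⟩ := h hs
  ⟨t, s', hexec, hs', hQ t s' hQs'⟩

theorem WP.set {d : ℕ} {o : Op} (ho : s.IsWordState w → o.val s < 2 ^ w)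
    (hQ : Q 1 (s.setReg d (o.val s))) : WP cmp w (.set d o) Q s := fun hs =>
  ⟨1, _, .set (ho hs), hs.setReg (ho hs) d, hQ⟩

theorem WP.const {d n : ℕ} (h : n < 2 ^ w) (hQ : Q 1 (s.setReg d n)) :
    WP cmp w (.set d (.const n)) Q s := .set (fun _ => h) hQ

theorem WP.copy {d a : ℕ} (hQ : Q 1 (s.setReg d (s.reg a))) :
    WP cmp w (.set d (.copy a)) Q s := .set (fun hs => hs.1 a) hQ

theorem WP.add {d a b : ℕ} (h : s.reg a + s.reg b < 2 ^ w)
    (hQ : Q 1 (s.setReg d (s.reg a + s.reg b))) : WP cmp w (.set d (.add a b)) Q s :=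
  .set (fun _ => h) hQ

theorem WP.half {d a : ℕ} (hQ : Q 1 (s.setReg d (s.reg a / 2))) :
    WP cmp w (.set d (.half a)) Q s :=
  .set (fun hs => (Nat.div_le_self _ _).trans_lt (hs.1 a)) hQ

theorem WP.load {d k a : ℕ} (hQ : Q 1 (s.setReg d (s.mem k (s.reg a)))) :
    WP cmp w (.set d (.load k a)) Q s := .set (fun hs => hs.2 k _) hQ

theorem WP.store {k a b : ℕ} (hQ : Q 1 (s.setMem k (s.reg a) (s.reg b))) :
    WP cmp w (.store k a b) Q s := fun hs =>
  ⟨1, _, .store, hs.setMem (hs.1 b) k (s.reg a), hQ⟩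

theorem WP.seq {p q : Prog}
    (h : WP cmp w p (fun t s' => WP cmp w q (fun t' s'' => Q (t + t') s'') s') s) :
    WP cmp w (.seq p q) Q s := fun hs =>
  let ⟨t, _, hp, hs', h'⟩ := h hs
  let ⟨t', s'', hq, hs'', hQ⟩ := h' hs'
  ⟨t + t', s'', .seq hp hq, hs'', hQ⟩

theorem WP.ite {c : Test} {p q : Prog}
    (hp : c.Holds cmp s → WP cmp w p (fun t s' => Q (t + 1) s') s)
    (hq : ¬ c.Holds cmp s → WP cmp w q (fun t s' => Q (t + 1) s') s) :
    WP cmp w (.ite c p q) Q s := fun hs => by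
  by_cases h : c.Holds cmp s
  · obtain ⟨t, s', hexec, hs', hQ⟩ := hp h hs
    exact ⟨t + 1, s', .ite_true h hexec, hs', hQ⟩
  · obtain ⟨t, s', hexec, hs', hQ⟩ := hq h hs
    exact ⟨t + 1, s', .ite_false h hexec, hs', hQ⟩

/-- The loop invariant `I n` carries a credit of `n` time units, which pays for the iterations. -/
theorem WP.while {c : Test} {p : Prog} (I : ℕ → State → Prop) {n : ℕ} (hn : I n s)
    (hI : ∀ n s, I n s → c.Holds cmp s →
      WP cmp w p (fun t s' => ∃ n', I n' s' ∧ t + 1 + n' ≤ n) s) :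
    WP cmp w (.while c p)
      (fun t s' => ∃ n', I n' s' ∧ ¬ c.Holds cmp s' ∧ t + n' ≤ n + 1) s := by
  induction n using Nat.strong_induction_on generalizing s with
  | _ n ih =>
    intro hs
    by_cases h : c.Holds cmp s
    · obtain ⟨t, s', hp, hs', n', hn', ht⟩ := hI n s hn h hs
      obtain ⟨t', s'', hloop, hs'', n'', hn'', hc, ht'⟩ := ih n' (by omega) hn' hs'
      exact ⟨t + t' + 1, s'', .while_true h hp hloop, hs'', n'', hn'', hc, by omega⟩
    · exact ⟨1, s, .while_false h, hs, n, hn, h, by omega⟩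

end WP

/-! ### Stored layouts -/

section Layout

variable [LT α] {T : List α} {G : Layout T}

theorem Layout.exists_node (G : Layout T) {v : Pos α} (hv : IsNode T v) :
    ∃ i, (G.node i).1 = v :=
  ⟨G.node.symm ⟨v, hv⟩, by rw [Equiv.apply_symm_apply]⟩

theorem Layout.exists_edge (G : Layout T) {e : Edge α} (he : IsEdge T e) :
    ∃ i, (G.edge i).1 = e :=
  ⟨G.edge.symm ⟨e, he⟩, by rw [Equiv.apply_symm_apply]⟩

theorem Layout.edge_injective (G : Layout T) {i j : Fin G.M}
    (h : (G.edge i).1 = (G.edge j).1) : i = j :=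
  G.edge.injective (Subtype.ext h)

theorem Layout.M_pos (G : Layout T) (hT : T ≠ []) : 0 < G.M :=
  have ⟨_, he⟩ := exists_isEdge_of_ne_nil hT
  (G.exists_edge he).choose.pos

theorem Layout.M_le_numExtensions (G : Layout T) : G.M ≤ numExtensions T := by
  rw [← Nat.card_fin G.M, Nat.card_congr G.edge]
  exact (finite_edges_and_ncard_le T).2

theorem Layout.Stored.exists_hi {s : State} (h : G.Stored s) (i : Fin G.M) :
    ∃ v : Fin G.N, (G.node v).1 = (G.edge i).1.hi ∧ s.mem 4 i = v :=
  have ⟨v, hv⟩ := G.exists_node (G.edge i).2.1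
  ⟨v, hv, h.hi i v hv.symm⟩

theorem Layout.Stored.exists_lo {s : State} (h : G.Stored s) (i : Fin G.M) :
    ∃ v : Fin G.N, (G.node v).1 = (G.edge i).1.lo ∧ s.mem 5 i = v :=
  have ⟨v, hv⟩ := G.exists_node (G.edge i).2.2.1
  ⟨v, hv, h.lo i v hv.symm⟩

theorem Layout.Stored.type_lo_eq_two_iff {s : State} (h : G.Stored s) (i : Fin G.M) :
    s.mem 0 (s.mem 5 i) = 2 ↔ IsType2 T (G.edge i).1.lo := by
  obtain ⟨v, hv, hlo⟩ := h.exists_lo i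
  rw [hlo, ← hv]
  refine ⟨fun h2 => (G.node v).2.resolve_left fun h1 => ?_, h.type2 v⟩
  rw [h.type1 v h1] at h2
  norm_num at h2

theorem Layout.Stored.out_le {s : State} (h : G.Stored s) {v : Fin G.N} {i : ℕ}
    (hi : s.mem 2 v ≤ i) (hi' : i < s.mem 3 v) : s.mem 3 v ≤ G.M := by
  obtain ⟨hlt, -⟩ := (h.out v (s.mem 3 v - 1)).1 ⟨by omega, by omega⟩
  omega

theorem Layout.Stored.degree_le_card [Fintype α] {s : State} (h : G.Stored s) (v : Fin G.N) :
    s.mem 3 v - s.mem 2 v ≤ Fintype.card α := by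
  have hout (i : Fin (s.mem 3 v - s.mem 2 v)) :
      ∃ hk : s.mem 2 v + i < G.M, (G.edge ⟨s.mem 2 v + i, hk⟩).1.hi = (G.node v).1 :=
    (h.out v (s.mem 2 v + i)).1 ⟨by omega, by omega⟩
  choose hk hhi using hout
  choose c hc using fun i => (G.edge ⟨_, hk i⟩).2.exists_first
  have hinj : Function.Injective c := fun i j hij => by
    have hedge := (G.edge ⟨_, hk i⟩).2.unique (G.edge ⟨_, hk j⟩).2 ((hhi i).trans (hhi j).symm)
      (hc i) (hij ▸ hc j)
    exact Fin.ext (Nat.add_left_cancel (Fin.ext_iff.1 (G.edge_injective hedge)))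
  simpa only [Fintype.card_fin] using Fintype.card_le_of_injective c hinj

/-- The state stores the graph and the constants of the program. The registers 2, 3 and 11 hold
the constants 1, 2 and 0, register 4 holds the number of the current edge, and the registers 5 to 9
are scratch. Of the arrays that the program writes, 7, 8 and 9 are those of `Layout.JumpsStored`,
where the cell of the edge `i` has the address `i + 1`, and array 10 holds the number of the first
edge of the edge suffix link of every edge. -/
structure Layout.Env (G : Layout T) (s : State) : Prop where
  stored : G.Stored s
  one : s.reg 2 = 1
  two : s.reg 3 = 2
  zero : s.reg 11 = 0

theorem Layout.Stored.of_eq {s s' : State} (h : G.Stored s) (h0 : s'.reg 0 = s.reg 0)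
    (h1 : s'.reg 1 = s.reg 1) (hm : ∀ k ≤ 6, s'.mem k = s.mem k) : G.Stored s' where
  numNodes := h0.trans h.numNodes
  numEdges := h1.trans h.numEdges
  type1 v hv := by rw [hm 0 (by norm_num)]; exact h.type1 v hv
  type2 v hv := by rw [hm 0 (by norm_num)]; exact h.type2 v hv
  slink v v' hv := by rw [hm 1 (by norm_num)]; exact h.slink v v' hv
  out v i := by rw [hm 2 (by norm_num), hm 3 (by norm_num)]; exact h.out v i
  hi i v hv := by rw [hm 4 (by norm_num)]; exact h.hi i v hv
  lo i v hv := by rw [hm 5 (by norm_num)]; exact h.lo i v hv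
  slen i := by rw [hm 6 (by norm_num)]; exact h.slen i

theorem Layout.Env.of_eq {s s' : State} (h : G.Env s)
    (hr : ∀ r, r < 4 ∨ r = 11 → s'.reg r = s.reg r) (hm : ∀ k ≤ 6, s'.mem k = s.mem k) :
    G.Env s' where
  stored := h.stored.of_eq (hr 0 (by norm_num)) (hr 1 (by norm_num)) hm
  one := (hr 2 (by norm_num)).trans h.one
  two := (hr 3 (by norm_num)).trans h.two
  zero := (hr 11 (by norm_num)).trans h.zero

@[simp]
theorem Layout.env_setReg_iff {s : State} {d n : ℕ} (hd : 4 ≤ d) (hd' : d ≠ 11) :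
    G.Env (s.setReg d n) ↔ G.Env s := by
  have hr (r : ℕ) (h : r < 4 ∨ r = 11) : (s.setReg d n).reg r = s.reg r :=
    Function.update_of_ne (by omega) _ _
  exact ⟨fun h => h.of_eq (fun r hr' => (hr r hr').symm) fun _ _ => rfl,
    fun h => h.of_eq hr fun _ _ => rfl⟩

@[simp]
theorem Layout.env_setMem_iff {s : State} {k i n : ℕ} (hk : 7 ≤ k) :
    G.Env (s.setMem k i n) ↔ G.Env s := by
  have hm (l : ℕ) (h : l ≤ 6) : (s.setMem k i n).mem l = s.mem l :=
    Function.update_of_ne (by omega) _ _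
  exact ⟨fun h => h.of_eq (fun _ _ => rfl) fun l hl => (hm l hl).symm,
    fun h => h.of_eq (fun _ _ => rfl) hm⟩

/-! ### Chains as linked lists -/

/-- `a` is the address of the cell of the edge that follows the edge `i` on its chain. -/
def Layout.NextAddr (G : Layout T) (i : Fin G.M) (a : ℕ) : Prop :=
  IsType1 T (G.edge i).1.lo ∧ a = 0 ∨
    IsType2 T (G.edge i).1.lo ∧ ∃ k : Fin G.M, (G.edge k).1.hi = (G.edge i).1.lo ∧ a = k + 1

/-- The memory `m` contains the cells of the edges numbered less than `n`. -/
def Layout.Cells (G : Layout T) (n : ℕ) (m : ℕ → ℕ → ℕ) : Prop :=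
  ∀ i : Fin G.M, (i : ℕ) < n → m 8 (i + 1) = i ∧ G.NextAddr i (m 9 (i + 1))

/-- `a` is the address of the cell of the first edge of the jump link of the edge `i`. -/
def Layout.JumpAddr (G : Layout T) (i : Fin G.M) (a : ℕ) : Prop :=
  ∃ k : Fin G.M, a = k + 1 ∧ ∃ p, IsJump T (G.edge i).1 ((G.edge k).1 :: p) ∧
    PieceChain T (G.edge k).1.hi ((G.edge k).1 :: p)

theorem Layout.NextAddr.eq_zero {i : Fin G.M} {a : ℕ} (h : G.NextAddr i a)
    (h1 : IsType1 T (G.edge i).1.lo) : a = 0 :=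
  (h.resolve_right fun h2 => h1.not_isType2 h2.1).2

theorem Layout.NextAddr.exists_edge {i : Fin G.M} {a : ℕ} (h : G.NextAddr i a)
    (h2 : IsType2 T (G.edge i).1.lo) :
    ∃ k : Fin G.M, (G.edge k).1.hi = (G.edge i).1.lo ∧ a = k + 1 :=
  (h.resolve_left fun h1 => h1.1.not_isType2 h2).2

theorem Layout.Stored.nextAddr_of_eq_two {s : State} (h : G.Stored s) (i : Fin G.M)
    (h2 : s.mem 0 (s.mem 5 i) = 2) :
    s.mem 2 (s.mem 5 i) < G.M ∧ G.NextAddr i (s.mem 2 (s.mem 5 i) + 1) := by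
  have ht := (h.type_lo_eq_two_iff i).1 h2
  obtain ⟨v, hv, hlo⟩ := h.exists_lo i
  obtain ⟨e, he, hhi⟩ := ht.exists_edge
  obtain ⟨k, rfl⟩ := G.exists_edge he
  have hk := (h.out v k).2 ⟨k.2, hhi.trans hv.symm⟩
  obtain ⟨hlt, hout⟩ := (h.out v (s.mem 2 v)).1 ⟨le_rfl, hk.1.trans_lt hk.2⟩
  rw [hlo]
  exact ⟨hlt, .inr ⟨ht, ⟨_, hlt⟩, hout.trans hv, rfl⟩⟩

theorem Layout.Stored.nextAddr_of_ne_two {s : State} (h : G.Stored s) (i : Fin G.M)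
    (h2 : s.mem 0 (s.mem 5 i) ≠ 2) : G.NextAddr i 0 :=
  .inl ⟨(G.edge i).2.2.1.resolve_right fun ht => h2 ((h.type_lo_eq_two_iff i).2 ht), rfl⟩

theorem Layout.Cells.exists_listAt {s : State} (h : G.Cells G.M s.mem) {v : Pos α}
    {p : List (Edge α)} (hp : PieceChain T v p) {i : Fin G.M} (hi : p.head? = some (G.edge i).1) :
    ∃ l : List (Fin G.M), l.map (fun j => (G.edge j).1) = p ∧
      ListAt s (i + 1) (l.map (fun j => (j : ℕ))) := by
  have cons {i : Fin G.M} {l : List ℕ} (hl : ListAt s (s.mem 9 (i + 1)) l) :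
      ListAt s (i + 1) (i :: l) := by
    have hcell := ListAt.cons (Nat.succ_ne_zero i) hl
    rwa [Nat.succ_eq_add_one, (h i i.2).1] at hcell
  induction hp generalizing i with
  | single he h1 =>
    obtain rfl := Option.some_inj.1 hi
    refine ⟨[i], rfl, cons ?_⟩
    rw [(h i i.2).2.eq_zero h1]
    exact .nil
  | @cons e p he h2 hp ih =>
    obtain rfl := Option.some_inj.1 hi
    obtain ⟨k, hk, hnext⟩ := (h i i.2).2.exists_edge h2
    obtain ⟨e', q, rfl, he', hhi⟩ := hp.exists_eq_cons
    obtain ⟨l, hl, hat⟩ := ih (i := k)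
      (congrArg some (h2.edge_unique he' (G.edge k).2 hhi hk))
    exact ⟨i :: l, by rw [List.map_cons, hl], cons (hnext ▸ hat)⟩

theorem Layout.Cells.jumpsStored {s : State} (h : G.Cells G.M s.mem)
    (hj : ∀ i : Fin G.M, 2 ≤ (G.edge i).1.slen → G.JumpAddr i (s.mem 7 i)) : G.JumpsStored s := by
  intro i p hi hp
  obtain ⟨k, hk, q, hq, hc⟩ := hj i hi
  obtain rfl := hp.unique hq
  rw [hk]
  exact h.exists_listAt hc rfl

theorem Layout.JumpAddr.ne_zero {i : Fin G.M} {a : ℕ} (h : G.JumpAddr i a) : a ≠ 0 := by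
  obtain ⟨k, rfl, -⟩ := h
  exact Nat.succ_ne_zero k

/-! ### Sequences of single edge suffix links -/

/-- In the memory `m`, array 7 holds the address of the jump link of the edge `i`, or array 10
refers to an edge with the same jump link. -/
def Layout.Linked (G : Layout T) (m : ℕ → ℕ → ℕ) (i : Fin G.M) : Prop :=
  m 7 i ≠ 0 ∧ G.JumpAddr i (m 7 i) ∨
    m 7 i = 0 ∧ ∃ k : Fin G.M, m 10 i = k ∧ IsESuf T (G.edge i).1 [(G.edge k).1]

/-- `FirstNonzero val f j d a`: in the sequence `j, f j, f (f j), …` the element with index `d` is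
the first one at which `val` does not vanish, and its value is `a`. -/
inductive FirstNonzero (val f : ℕ → ℕ) : ℕ → ℕ → ℕ → Prop
  | zero {j : ℕ} : val j ≠ 0 → FirstNonzero val f j 0 (val j)
  | succ {j d a : ℕ} :
      val j = 0 → FirstNonzero val f (f j) d a → FirstNonzero val f j (d + 1) a

namespace FirstNonzero

variable {val f : ℕ → ℕ} {j d a : ℕ}

theorem eq_zero_iff (h : FirstNonzero val f j d a) : d = 0 ↔ val j ≠ 0 := by
  cases h with
  | zero hj => exact ⟨fun _ => hj, fun _ => rfl⟩
  | succ hj _ => exact ⟨fun h => absurd h (Nat.succ_ne_zero _), fun h => absurd hj h⟩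

theorem val_eq (h : FirstNonzero val f j d a) (hj : val j ≠ 0) : val j = a := by
  cases h with
  | zero _ => rfl
  | succ h0 _ => exact absurd h0 hj

theorem exists_succ (h : FirstNonzero val f j d a) (hj : val j = 0) :
    ∃ d', d = d' + 1 ∧ FirstNonzero val f (f j) d' a := by
  cases h with
  | zero h0 => exact absurd hj h0
  | succ _ h => exact ⟨_, rfl, h⟩

theorem index_unique {d' a' : ℕ} (h : FirstNonzero val f j d a)
    (h' : FirstNonzero val f j d' a') : d = d' := by
  induction h generalizing d' with
  | zero hj => exact (h'.eq_zero_iff.2 hj).symm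
  | succ hj _ ih =>
    obtain ⟨e, rfl, hr⟩ := h'.exists_succ hj
    rw [ih hr]

/-- The sequence started at `k` does not meet `j`, from where it would take more than `d` steps. -/
theorem update {k d' a' : ℕ} (h : FirstNonzero val f k d a) (h' : FirstNonzero val f j d' a')
    (hlt : d < d') (x : ℕ) : FirstNonzero (Function.update val j x) f k d a := by
  have update_eq {k d a : ℕ} (h : FirstNonzero val f k d a) (hlt : d < d') :
      Function.update val j x k = val k :=
    Function.update_of_ne (fun hkj => hlt.ne (h.index_unique (hkj ▸ h'))) _ _
  induction h with
  | zero hk =>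
    have heq := update_eq (.zero hk) hlt
    rw [← heq]
    exact .zero (by rwa [heq])
  | succ hk hr ih =>
    exact .succ (by rwa [update_eq (.succ hk hr) hlt]) (ih (Nat.lt_of_succ_lt hlt))

end FirstNonzero

theorem Layout.Linked.exists_isESuf {m : ℕ → ℕ → ℕ} {i : Fin G.M} (h : G.Linked m i)
    (h7 : m 7 i = 0) : ∃ k : Fin G.M, m 10 i = k ∧ IsESuf T (G.edge i).1 [(G.edge k).1] :=
  (h.resolve_left fun h' => h'.1 h7).2

theorem Layout.Linked.jumpAddr {m : ℕ → ℕ → ℕ} {i : Fin G.M} (h : G.Linked m i)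
    (h7 : m 7 i ≠ 0) : G.JumpAddr i (m 7 i) :=
  (h.resolve_right fun h' => h7 h'.1).2

theorem Layout.Linked.update {m : ℕ → ℕ → ℕ} {a : ℕ} {i j : Fin G.M} (hi : G.Linked m i)
    (ha : G.JumpAddr j a) :
    G.Linked (Function.update m 7 (Function.update (m 7) j a)) i := by
  rcases eq_or_ne i j with rfl | hij
  · exact .inl (by simpa using ⟨ha.ne_zero, ha⟩)
  · simpa [Layout.Linked, Fin.val_injective.ne hij] using hi

theorem Layout.exists_firstNonzero {m : ℕ → ℕ → ℕ}
    (h : ∀ i : Fin G.M, 2 ≤ (G.edge i).1.slen → G.Linked m i) {i : Fin G.M}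
    (hi : 2 ≤ (G.edge i).1.slen) : ∃ d a, FirstNonzero (m 7) (m 10) i d a := by
  induction hv : (G.edge i).1.hi using (wellFounded_isSlink T).induction generalizing i with
  | _ v ih =>
    subst hv
    by_cases h7 : m 7 i = 0
    · obtain ⟨k, hk, hs⟩ := (h i hi).exists_isESuf h7
      obtain ⟨d, a, hr⟩ := ih _ hs.isSlink_head (by rwa [Edge.slen, hs.lab_eq]) rfl
      exact ⟨d + 1, a, .succ h7 (hk ▸ hr)⟩
    · exact ⟨0, _, .zero h7⟩

theorem FirstNonzero.jumpAddr {m : ℕ → ℕ → ℕ}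
    (h : ∀ i : Fin G.M, 2 ≤ (G.edge i).1.slen → G.Linked m i) {i : Fin G.M} {d a : ℕ}
    (hi : 2 ≤ (G.edge i).1.slen) (hr : FirstNonzero (m 7) (m 10) i d a) : G.JumpAddr i a := by
  induction d generalizing i with
  | zero =>
    have h7 := hr.eq_zero_iff.1 rfl
    exact hr.val_eq h7 ▸ (h i hi).jumpAddr h7
  | succ d ih =>
    have h7 := not_ne_iff.1 (mt hr.eq_zero_iff.2 (Nat.succ_ne_zero d))
    obtain ⟨k, hk, hs⟩ := (h i hi).exists_isESuf h7
    obtain ⟨_, hd, hr⟩ := hr.exists_succ h7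
    obtain rfl := Nat.succ_injective hd
    obtain ⟨l, rfl, p, hp, hc⟩ := ih (i := k) (by rwa [Edge.slen, hs.lab_eq]) (hk ▸ hr)
    exact ⟨l, rfl, p, .single (G.edge i).2 hi hs hp, hc⟩

end Layout

/-! ### First characters -/

theorem FirstCharLT.asymm [Preorder α] {e f : Edge α} (h : FirstCharLT e f) :
    ¬ FirstCharLT f e := by
  rintro ⟨b', a', y', x', hf', he', hlt'⟩
  obtain ⟨a, b, x, y, he, hf, hlt⟩ := h
  obtain rfl := (List.cons.inj (he.symm.trans he')).1
  obtain rfl := (List.cons.inj (hf.symm.trans hf')).1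
  exact lt_asymm hlt hlt'

theorem firstCharLT_iff_of_prefix [LT α] {e e' f : Edge α} (hlab : e'.lab ≠ [])
    (h : e'.lab <+: e.lab) : FirstCharLT e f ↔ FirstCharLT e' f := by
  obtain ⟨c, r, hc⟩ := List.exists_cons_of_ne_nil hlab
  obtain ⟨q, hq⟩ := h
  simp only [FirstCharLT, ← hq, hc, List.cons_append, List.cons.injEq, exists_and_left,
    exists_eq_left', and_assoc, exists_and_right]

theorem Layout.firstCharLT_iff_lt [Preorder α] {T : List α} (G : Layout T) {i j : Fin G.M}
    (h : (G.edge i).1.hi = (G.edge j).1.hi) :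
    FirstCharLT (G.edge i).1 (G.edge j).1 ↔ i < j := by
  refine ⟨fun hlt => ?_, fun hlt => G.sorted i j hlt h⟩
  by_contra! hle
  rcases hle.eq_or_lt with rfl | hlt'
  · exact hlt.asymm hlt
  · exact hlt.asymm (G.sorted j i hlt' h.symm)

theorem Layout.cmp_iff_lt [Preorder α] {T : List α} (G : Layout T) {i k m : Fin G.M}
    (hlab : (G.edge k).1.lab <+: (G.edge i).1.lab) (hhi : (G.edge k).1.hi = (G.edge m).1.hi) :
    G.cmp i m ↔ k < m := by
  have hiff := (firstCharLT_iff_of_prefix (f := (G.edge m).1) (G.edge k).2.2.2.1 hlab).trans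
    (G.firstCharLT_iff_lt hhi)
  exact ⟨fun ⟨_, _, h⟩ => hiff.1 h, fun h => ⟨i.2, m.2, hiff.2 h⟩⟩

/-! ### The program -/

/-- A program of one step that changes scratch register 5 only. -/
def skip : Prog := .set 5 (.copy 11)

/-- Runs `p` for every edge, with the number of the edge in register 4. -/
def forEdges (p : Prog) : Prog :=
  .seq (.set 4 (.copy 11)) (.while (.lt 4 1) (.seq p (.set 4 (.add 4 2))))

/-- Runs `p` if the current edge has string length at least 2. -/
def ifLong (p : Prog) : Prog := .seq (.set 5 (.load 6 4)) (.ite (.lt 5 3) skip p)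

/-- Writes the cell of the current edge and clears its jump link. -/
def writeCell : Prog :=
  .seq (.set 5 (.load 5 4)) <| .seq (.set 6 (.load 0 5)) <| .seq (.set 7 (.add 4 2)) <|
  .seq (.store 8 7 4) <|
  .seq (.ite (.eq 6 3) (.seq (.set 8 (.load 2 5)) (.set 8 (.add 8 2))) (.set 8 (.copy 11))) <|
  .seq (.store 9 7 8) (.store 7 4 11)

/-- Loads the interval of the edges that leave the suffix link of the upper end of the current edge
to the registers 7 and 8. -/
def loadInterval : Prog :=
  .seq (.set 6 (.load 4 4)) <| .seq (.set 6 (.load 1 6)) <| .seq (.set 7 (.load 2 6)) <|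
  .seq (.set 8 (.load 3 6)) (.set 9 (.add 7 2))

/-- Halves the interval in the registers 7 and 8 by a comparison with the first character of the
current edge. Register 9 holds the successor of register 7. -/
def searchStep : Prog :=
  .seq (.set 9 (.add 7 8)) <| .seq (.set 9 (.half 9)) <|
  .seq (.ite (.chr 4 9) (.set 8 (.copy 9)) (.set 7 (.copy 9))) (.set 9 (.add 7 2))

/-- Records the edge in register 7 as the first edge of the edge suffix link of the current edge,
and its chain as the jump link if it has further edges. -/
def storeLink : Prog :=
  .seq (.store 10 4 7) <| .seq (.set 5 (.load 9 9)) (.ite (.eq 5 11) skip (.store 7 4 9))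

/-- Finds the edge suffix link of the current edge. -/
def linkEdge : Prog := .seq loadInterval (.seq (.while (.lt 9 8) searchStep) storeLink)

/-- Follows the edges in array 10 from the current edge to the first one with a known jump link,
which is left in register 7. -/
def findJump : Prog :=
  .seq (.set 6 (.copy 4)) <| .seq (.set 7 (.load 7 6)) <|
  .while (.eq 7 11) (.seq (.set 6 (.load 10 6)) (.set 7 (.load 7 6)))

/-- Makes register 7 the jump link of the edges passed by `findJump`. -/
def compressPath : Prog :=
  .seq (.set 6 (.copy 4)) <| .seq (.set 8 (.load 7 6)) <|
  .while (.eq 8 11) (.seq (.store 7 6 7) <| .seq (.set 6 (.load 10 6)) (.set 8 (.load 7 6)))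

/-- The computation of all jump links. -/
def jumpProgram : Prog :=
  .seq (.set 2 (.const 1)) <| .seq (.set 3 (.const 2)) <| .seq (.set 11 (.const 0)) <|
  .seq (forEdges writeCell) <| .seq (forEdges (ifLong linkEdge))
    (forEdges (ifLong (.seq findJump compressPath)))

section Layout

variable [LT α] {T : List α} {G : Layout T} {w : ℕ}

theorem forEdges_spec {p : Prog} (B : ℕ) (Φ : (ℕ → ℕ → ℕ) → ℕ) (J : ℕ → (ℕ → ℕ → ℕ) → Prop)
    {s : State} (hs : G.Env s) (hw : G.M < 2 ^ w) (h0 : J 0 s.mem)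
    (hp : ∀ (i : Fin G.M) (s : State), G.Env s → s.reg 4 = i → J i s.mem →
      WP G.cmp w p (fun t s' => G.Env s' ∧ s'.reg 4 = i ∧ J (i + 1) s'.mem ∧
        t + Φ s'.mem ≤ Φ s.mem + B) s) :
    WP G.cmp w (forEdges p) (fun t s' => G.Env s' ∧ J G.M s'.mem ∧
      t + Φ s'.mem ≤ Φ s.mem + (B + 2) * G.M + 2) s := by
  refine .seq <| .copy <| (WP.while (n := Φ s.mem + (B + 2) * G.M)
    (fun n s => G.Env s ∧ s.reg 4 ≤ G.M ∧ J (s.reg 4) s.mem ∧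
      n = Φ s.mem + (B + 2) * (G.M - s.reg 4)) (by simpa [hs, hs.zero] using h0) ?_).mono ?_
  · rintro n s ⟨hs, -, hJ, rfl⟩ (hlt : s.reg 4 < s.reg 1)
    rw [hs.stored.numEdges] at hlt
    refine .seq <| (hp ⟨s.reg 4, hlt⟩ s hs rfl hJ).mono ?_
    rintro t s' ⟨hs', h4, hJ', ht⟩
    have hpot : (B + 2) * (G.M - s.reg 4) = (B + 2) * (G.M - (s.reg 4 + 1)) + (B + 2) := by
      rw [← Nat.mul_succ, Nat.succ_eq_add_one, Nat.sub_add_eq, Nat.sub_add_cancel (by omega)]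
    refine .add (by rw [h4, hs'.one]; dsimp only; omega) ⟨_, ⟨?_, ?_, ?_, rfl⟩, ?_⟩
    · simpa using hs'
    · simpa [h4, hs'.one] using hlt
    · simpa [h4, hs'.one] using hJ'
    · simp only [State.setReg_reg, State.setReg_mem, Function.update_self, h4, hs'.one]
      omega
  · rintro t s' ⟨n, ⟨hs', hi, hJ, rfl⟩, hlt, ht⟩
    have hM : s'.reg 4 = G.M := hi.antisymm (hs'.stored.numEdges ▸ not_lt.1 hlt)
    rw [hM] at hJ ht
    exact ⟨hs', hJ, by omega⟩

theorem ifLong_spec {p : Prog} {Q : ℕ → State → Prop} {s : State} (hs : G.Env s) {i : Fin G.M}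
    (h4 : s.reg 4 = i)
    (hshort : (G.edge i).1.slen < 2 → Q 3 ((s.setReg 5 (G.edge i).1.slen).setReg 5 0))
    (hlong : 2 ≤ (G.edge i).1.slen →
      WP G.cmp w p (fun t s' => Q (t + 2) s') (s.setReg 5 (G.edge i).1.slen)) :
    WP G.cmp w (ifLong p) Q s := by
  refine .seq <| .load ?_
  rw [h4, hs.stored.slen]
  refine .ite (fun h => .copy ?_) fun h => ?_
  · simpa [hs.zero] using hshort (by simpa [Test.Holds, hs.two] using h)
  · exact (hlong (not_lt.1 (by simpa [Test.Holds, hs.two] using h))).mono fun t _ hQ => by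
      rwa [Nat.add_comm 1]

theorem writeCell_spec {s : State} (hs : G.Env s) (hw : G.M < 2 ^ w) {i : Fin G.M}
    (h4 : s.reg 4 = i) :
    WP G.cmp w writeCell (fun t s' => t ≤ 9 ∧ G.Env s' ∧ s'.reg 4 = i ∧
      ∃ a, G.NextAddr i a ∧
        s'.mem = (((s.setMem 8 (i + 1) i).setMem 9 (i + 1) a).setMem 7 i 0).mem) s := by
  have hreg : s.reg 4 + 1 < 2 ^ w := by omega
  refine .seq <| .load <| .seq <| .load <| .seq <| .add (by simpa [hs.one] using hreg) <|
    .seq <| .store <| .seq <| .ite (fun h => ?_) fun h => ?_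
  · replace h : s.mem 0 (s.mem 5 i) = 2 := by simpa [Test.Holds, h4, hs.two] using h
    obtain ⟨hlt, hnext⟩ := hs.stored.nextAddr_of_eq_two i h
    refine .seq <| .load <| .add ?_ <| .seq <| .store <| .store ⟨by norm_num, ?_⟩
    · simpa [h4, hs.one] using Nat.lt_of_le_of_lt hlt hw
    · exact ⟨by simpa using hs, by simpa using h4, _, hnext, by simp [h4, hs.one, hs.zero]⟩
  · replace h : s.mem 0 (s.mem 5 i) ≠ 2 := by simpa [Test.Holds, h4, hs.two] using h
    refine .copy <| .seq <| .store <| .store ⟨by norm_num, ?_⟩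
    exact ⟨by simpa using hs, by simpa using h4, _, hs.stored.nextAddr_of_ne_two i h,
      by simp [h4, hs.one, hs.zero]⟩

theorem Layout.Cells.succ {m : ℕ → ℕ → ℕ} {i : Fin G.M} (h : G.Cells i m) {s : State} {a : ℕ}
    (ha : G.NextAddr i a) (hm : s.mem = m) :
    G.Cells (i + 1) (((s.setMem 8 (i + 1) i).setMem 9 (i + 1) a).setMem 7 i 0).mem := by
  subst hm
  intro j hj
  rcases Nat.lt_succ_iff_lt_or_eq.1 hj with hj | hj
  · simpa [hj.ne] using h j hj
  · obtain rfl := Fin.ext hj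
    simpa using ha

theorem writeCells_spec {s : State} (hs : G.Env s) (hw : G.M < 2 ^ w) :
    WP G.cmp w (forEdges writeCell) (fun t s' => t ≤ 11 * G.M + 2 ∧ G.Env s' ∧
      G.Cells G.M s'.mem ∧ ∀ i : Fin G.M, s'.mem 7 i = 0) s := by
  refine (forEdges_spec 9 (fun _ => 0)
    (fun n m => G.Cells n m ∧ ∀ j : Fin G.M, (j : ℕ) < n → m 7 j = 0) hs hw
    ⟨fun _ h => absurd h (Nat.not_lt_zero _), fun _ h => absurd h (Nat.not_lt_zero _)⟩ ?_).mono ?_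
  · rintro i s hs h4 ⟨hc, hz⟩
    refine (writeCell_spec hs hw h4).mono ?_
    rintro t s' ⟨ht, hs', h4', a, ha, hm⟩
    rw [hm]
    refine ⟨hs', h4', ⟨hc.succ ha rfl, fun j hj => ?_⟩, by omega⟩
    rcases Nat.lt_succ_iff_lt_or_eq.1 hj with hj | hj
    · simpa [hj.ne] using hz j hj
    · simp [hj]
  · rintro t s' ⟨hs', ⟨hc, hz⟩, ht⟩
    exact ⟨by omega, hs', hc, fun i => hz i i.2⟩

end Layout

/-! ### Binary search -/

theorem clog_add_one_le_clog {n m : ℕ} (hn : 2 ≤ n) (hm : m ≤ (n + 1) / 2) :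
    Nat.clog 2 m + 1 ≤ Nat.clog 2 n := by
  rw [Nat.clog_of_two_le one_lt_two hn]
  exact Nat.succ_le_succ (Nat.clog_mono_right 2 hm)

section Layout

variable [LT α] {T : List α} {G : Layout T} {w : ℕ}

/-- The state of the binary search for the edge `i` with the interval from `l` to `r`, over the
memory `m`. -/
structure Layout.Searching (G : Layout T) (m : ℕ → ℕ → ℕ) (i l r : ℕ) (s : State) : Prop where
  env : G.Env s
  mem : s.mem = m
  current : s.reg 4 = i
  left : s.reg 7 = l
  right : s.reg 8 = r
  left_succ : s.reg 9 = l + 1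

theorem searchStep_spec {m : ℕ → ℕ → ℕ} {i l r : ℕ} {s : State} (h : G.Searching m i l r s)
    (hlr : l + 1 < r) (hw : l + r < 2 ^ w) :
    WP G.cmp w searchStep (fun t s' => t = 5 ∧
      (G.cmp i ((l + r) / 2) → G.Searching m i l ((l + r) / 2) s') ∧
      (¬ G.cmp i ((l + r) / 2) → G.Searching m i ((l + r) / 2) r s')) s := by
  obtain ⟨hs, rfl, rfl, rfl, rfl, -⟩ := h
  refine .seq <| .add hw <| .seq <| .half <| .seq <|
    .ite (fun h => .copy <| .add ?_ ⟨rfl, fun _ => ?_, fun h' => absurd ?_ h'⟩)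
      (fun h => .copy <| .add ?_ ⟨rfl, fun h' => absurd h' ?_, fun _ => ?_⟩)
  · simpa [hs.one] using by omega
  · exact ⟨by simpa using hs, rfl, by simp, by simp, by simp, by simp [hs.one]⟩
  · simpa [Test.Holds] using h
  · simpa [hs.one] using by omega
  · simpa [Test.Holds] using h
  · exact ⟨by simpa using hs, rfl, by simp, by simp, by simp, by simp [hs.one]⟩

theorem search_spec {m : ℕ → ℕ → ℕ} {i k L R : ℕ} {s : State} (h : G.Searching m i L R s)
    (hLk : L ≤ k) (hkR : k < R) (hw : 2 * R ≤ 2 ^ w)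
    (hcmp : ∀ j, L ≤ j → j < R → (G.cmp i j ↔ k < j)) :
    WP G.cmp w (.while (.lt 9 8) searchStep) (fun t s' => t ≤ 6 * Nat.clog 2 (R - L) + 1 ∧
      G.Searching m i k (k + 1) s') s := by
  refine (WP.while (fun n s' => ∃ l r, G.Searching m i l r s' ∧ L ≤ l ∧ l ≤ k ∧ k < r ∧ r ≤ R ∧
    n = 6 * Nat.clog 2 (r - l)) ⟨L, R, h, le_rfl, hLk, hkR, le_rfl, rfl⟩ ?_).mono ?_
  · rintro n s' ⟨l, r, h, hl, hlk, hkr, hr, rfl⟩ (hlt : s'.reg 9 < s'.reg 8)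
    rw [h.left_succ, h.right] at hlt
    refine (searchStep_spec h hlt (by omega)).mono ?_
    rintro t s'' ⟨rfl, hleft, hright⟩
    rw [hcmp _ (by omega) (by omega)] at hleft hright
    rcases lt_or_ge k ((l + r) / 2) with hk | hk
    · have := clog_add_one_le_clog (n := r - l) (m := (l + r) / 2 - l) (by omega) (by omega)
      exact ⟨_, ⟨l, (l + r) / 2, hleft hk, hl, hlk, hk, by omega, rfl⟩, by omega⟩
    · have := clog_add_one_le_clog (n := r - l) (m := r - (l + r) / 2) (by omega) (by omega)
      exact ⟨_, ⟨(l + r) / 2, r, hright hk.not_gt, by omega, hk, hkr, hr, rfl⟩, by omega⟩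
  · rintro t s' ⟨n, ⟨l, r, h, -, hlk, hkr, -, rfl⟩, (hlt : ¬ s'.reg 9 < s'.reg 8), ht⟩
    rw [h.left_succ, h.right] at hlt
    obtain rfl : l = k := by omega
    obtain rfl : r = l + 1 := by omega
    exact ⟨by omega, h⟩

theorem loadInterval_spec {s : State} (hs : G.Env s) {i v : ℕ} (h4 : s.reg 4 = i)
    (hv : s.mem 1 (s.mem 4 i) = v) (hw : s.mem 2 v + 1 < 2 ^ w) :
    WP G.cmp w loadInterval
      (fun t s' => t = 5 ∧ G.Searching s.mem i (s.mem 2 v) (s.mem 3 v) s') s := by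
  subst h4 hv
  refine .seq <| .load <| .seq <| .load <| .seq <| .load <| .seq <| .load <|
    .add (by simpa [hs.one] using hw) ⟨rfl, ?_⟩
  exact ⟨by simpa using hs, rfl, by simp, by simp, by simp, by simp [hs.one]⟩

/-! ### Edge suffix links -/

theorem Layout.Cells.linked_of_isESuf {m : ℕ → ℕ → ℕ} (hc : G.Cells G.M m) {i k : Fin G.M}
    (hi : 2 ≤ (G.edge i).1.slen) {v : Pos α} {p : List (Edge α)}
    (hs : IsESuf T (G.edge i).1 ((G.edge k).1 :: p)) (hp : PieceChain T v ((G.edge k).1 :: p))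
    (h10 : m 10 i = k) (h7 : m 7 i = if m 9 (k + 1) = 0 then 0 else (k : ℕ) + 1) :
    G.Linked m i := by
  have hnext := (hc k k.2).2
  cases hp with
  | single he h1 =>
    rw [if_pos (hnext.eq_zero h1)] at h7
    exact .inr ⟨h7, k, h10, hs⟩
  | cons he h2 hp' =>
    obtain ⟨l, -, hl⟩ := hnext.exists_edge h2
    rw [if_neg (by omega)] at h7
    refine .inl ⟨by omega, k, h7, _, .path (G.edge i).2 hi hs ?_, .cons he h2 hp'⟩
    obtain ⟨e, q, rfl, -⟩ := hp'.exists_eq_cons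
    exact Nat.le_add_left 2 _

theorem storeLink_spec {m : ℕ → ℕ → ℕ} {i k r : ℕ} {s : State} (h : G.Searching m i k r s)
    (h7 : m 7 i = 0) :
    WP G.cmp w storeLink (fun t s' => t ≤ 4 ∧ G.Env s' ∧ s'.reg 4 = i ∧
      s'.mem 7 = Function.update (m 7) i (if m 9 (k + 1) = 0 then 0 else k + 1) ∧
      s'.mem 10 = Function.update (m 10) i k ∧ ∀ l, l ≠ 7 → l ≠ 10 → s'.mem l = m l) s := by
  obtain ⟨hs, rfl, rfl, rfl, -, h9⟩ := h
  refine .seq <| .store <| .seq <| .load <| .ite (fun h => .copy ⟨le_rfl, ?_⟩)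
    (fun h => .store ⟨le_rfl, ?_⟩)
  · replace h : s.mem 9 (s.reg 7 + 1) = 0 := by simpa [Test.Holds, h9, hs.zero] using h
    refine ⟨by simpa using hs, by simp, ?_, by simp, fun l _ hl => by simp [hl]⟩
    simp [h, ← h7]
  · replace h : s.mem 9 (s.reg 7 + 1) ≠ 0 := by simpa [Test.Holds, h9, hs.zero] using h
    refine ⟨by simpa using hs, by simp, by simp [h, h9], by simp, fun l hl hl' => by simp [hl, hl']⟩

/-- The memory `m` during the computation of the edge suffix links, which are known for the edges
numbered less than `n`. -/
structure Layout.LinkedBelow (G : Layout T) (n : ℕ) (m : ℕ → ℕ → ℕ) : Prop where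
  cells : G.Cells G.M m
  linked : ∀ i : Fin G.M, (i : ℕ) < n → 2 ≤ (G.edge i).1.slen → G.Linked m i
  eq_zero : ∀ i : Fin G.M, n ≤ i → m 7 i = 0

theorem Layout.LinkedBelow.succ_of_slen_lt {i : Fin G.M} {m : ℕ → ℕ → ℕ}
    (h : G.LinkedBelow i m) (hi : (G.edge i).1.slen < 2) : G.LinkedBelow (i + 1) m where
  cells := h.cells
  linked j hj hlen := by
    rcases Nat.lt_succ_iff_lt_or_eq.1 hj with hj | hj
    · exact h.linked j hj hlen
    · exact absurd hi (Fin.ext hj ▸ hlen).not_gt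
  eq_zero j hj := h.eq_zero j (Nat.le_of_succ_le hj)

theorem Layout.LinkedBelow.succ {i k : Fin G.M} {m m' : ℕ → ℕ → ℕ} (h : G.LinkedBelow i m)
    (hi : 2 ≤ (G.edge i).1.slen) {v : Pos α} {p : List (Edge α)}
    (hs : IsESuf T (G.edge i).1 ((G.edge k).1 :: p)) (hp : PieceChain T v ((G.edge k).1 :: p))
    (h7 : m' 7 = Function.update (m 7) i (if m 9 (k + 1) = 0 then 0 else (k : ℕ) + 1))
    (h10 : m' 10 = Function.update (m 10) i k) (hm : ∀ l, l ≠ 7 → l ≠ 10 → m' l = m l) :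
    G.LinkedBelow (i + 1) m' := by
  have h9 : m' 9 = m 9 := hm 9 (by norm_num) (by norm_num)
  have hcells : G.Cells G.M m' := fun j hj => by
    rw [hm 8 (by norm_num) (by norm_num), h9]
    exact h.cells j hj
  refine ⟨hcells, fun j hj hlen => ?_, fun j hj => ?_⟩
  · rcases Nat.lt_succ_iff_lt_or_eq.1 hj with hj | hj
    · have hlinked := h.linked j hj hlen
      rwa [Layout.Linked, h7, h10, Function.update_of_ne hj.ne, Function.update_of_ne hj.ne]
    · obtain rfl := Fin.ext hj
      exact hcells.linked_of_isESuf hi hs hp (by rw [h10, Function.update_self])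
        (by rw [h7, Function.update_self, h9])
  · rw [h7, Function.update_of_ne (Nat.lt_of_succ_le hj).ne']
    exact h.eq_zero j (Nat.le_of_succ_le hj)

end Layout

section Preorder

variable [Fintype α] [Preorder α] {T : List α} {G : Layout T} {w : ℕ}

theorem linkEdge_spec {s : State} (hs : G.Env s) {i : Fin G.M} (h4 : s.reg 4 = i)
    (hw : 2 * G.M ≤ 2 ^ w) (hlen : 2 ≤ (G.edge i).1.slen) (h : G.LinkedBelow i s.mem) :
    WP G.cmp w linkEdge (fun t s' => t ≤ 6 * Nat.clog 2 (Fintype.card α) + 10 ∧ G.Env s' ∧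
      s'.reg 4 = i ∧ G.LinkedBelow (i + 1) s'.mem) s := by
  obtain ⟨_, p, -, hp, hsuf⟩ := (G.edge i).2.exists_esuf hlen
  obtain ⟨e, p, rfl, he, -⟩ := hp.exists_eq_cons
  obtain ⟨k, rfl⟩ := G.exists_edge he
  obtain ⟨v, hv, hmem⟩ := hs.stored.exists_hi i
  obtain ⟨v', hv', -⟩ := hs.stored.exists_hi k
  have hslink : s.mem 1 (s.mem 4 i) = v' := by
    rw [hmem]
    exact hs.stored.slink v v' (by rw [hv, hv']; exact hsuf.isSlink_head)
  obtain ⟨hLk, hkR⟩ := (hs.stored.out v' k).2 ⟨k.2, hv'.symm⟩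
  have hRM : s.mem 3 v' ≤ G.M := hs.stored.out_le hLk hkR
  have hcmp (j : ℕ) (hj : s.mem 2 v' ≤ j) (hj' : j < s.mem 3 v') :
      G.cmp i j ↔ (k : ℕ) < j := by
    obtain ⟨hjM, hhi⟩ := (hs.stored.out v' j).1 ⟨hj, hj'⟩
    exact G.cmp_iff_lt (m := ⟨j, hjM⟩) hsuf.lab_head_prefix (hv'.symm.trans hhi.symm)
  refine .seq <| (loadInterval_spec hs h4 hslink (by omega)).mono ?_
  rintro _ s₁ ⟨rfl, hsearch⟩
  refine .seq <| (search_spec hsearch hLk hkR (by omega) hcmp).mono ?_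
  rintro t₂ s₂ ⟨ht₂, h₂⟩
  refine (storeLink_spec h₂ (h.eq_zero i le_rfl)).mono ?_
  rintro t₃ s₃ ⟨ht₃, hs₃, h4₃, h7, h10, hm⟩
  have hclog := Nat.clog_mono_right 2 (hs.stored.degree_le_card v')
  exact ⟨by omega, hs₃, h4₃, h.succ hlen hsuf hp h7 h10 hm⟩

theorem linkEdges_spec {s : State} (hs : G.Env s) (hw : 2 * G.M ≤ 2 ^ w)
    (h : G.LinkedBelow 0 s.mem) :
    WP G.cmp w (forEdges (ifLong linkEdge)) (fun t s' =>
      t ≤ (6 * Nat.clog 2 (Fintype.card α) + 14) * G.M + 2 ∧ G.Env s' ∧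
        G.LinkedBelow G.M s'.mem) s := by
  have hpos := Nat.two_pow_pos w
  refine (forEdges_spec (6 * Nat.clog 2 (Fintype.card α) + 12) (fun _ => 0) G.LinkedBelow hs
    (by omega) h fun i s hs h4 hi => ifLong_spec hs h4 (fun hlt => ?_) fun hlen => ?_).mono ?_
  · exact ⟨by simpa using hs, by simpa using h4, hi.succ_of_slen_lt hlt, by omega⟩
  · have hs₁ : G.Env (s.setReg 5 (G.edge i).1.slen) := by simpa using hs
    refine (linkEdge_spec hs₁ (by simpa using h4) hw hlen hi).mono ?_
    rintro t s' ⟨ht, hs', h4', hi'⟩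
    exact ⟨hs', h4', hi', by omega⟩
  · rintro t s' ⟨hs', h', ht⟩
    exact ⟨by simpa using ht, hs', h'⟩

end Preorder

/-! ### Path compression -/

/-- The number of zeros among the first `n` values, which is the potential in the analysis of the
path compression. -/
def numZeros (n : ℕ) (f : ℕ → ℕ) : ℕ := ((Finset.range n).filter fun j => f j = 0).card

theorem numZeros_le (n : ℕ) (f : ℕ → ℕ) : numZeros n f ≤ n := by
  simpa [numZeros] using Finset.card_filter_le (Finset.range n) fun j => f j = 0

theorem numZeros_update_add_one {n j a : ℕ} {f : ℕ → ℕ} (hj : j < n) (h0 : f j = 0)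
    (ha : a ≠ 0) : numZeros n (Function.update f j a) + 1 = numZeros n f := by
  have herase : ((Finset.range n).filter fun k => Function.update f j a k = 0) =
      ((Finset.range n).filter fun k => f k = 0).erase j := by
    ext k
    by_cases hk : k = j
    · simp [hk, ha]
    · simp [hk]
  rw [numZeros, herase, Finset.card_erase_add_one (by simp [hj, h0]), numZeros]

section Layout

variable [LT α] {T : List α} {G : Layout T} {w : ℕ}

theorem findJump_spec {s : State} (hs : G.Env s) {i d a : ℕ} (h4 : s.reg 4 = i)
    (hr : FirstNonzero (s.mem 7) (s.mem 10) i d a) :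
    WP G.cmp w findJump (fun t s' => t ≤ 3 * d + 3 ∧ G.Env s' ∧ s'.mem = s.mem ∧
      s'.reg 4 = i ∧ s'.reg 7 = a) s := by
  refine .seq <| .copy <| .seq <| .load <| (WP.while (n := 3 * d) (fun n s' => G.Env s' ∧
    s'.mem = s.mem ∧ s'.reg 4 = i ∧ s'.reg 7 = s.mem 7 (s'.reg 6) ∧
      ∃ d, FirstNonzero (s.mem 7) (s.mem 10) (s'.reg 6) d a ∧ n = 3 * d)
    ⟨by simpa using hs, by simp, by simpa using h4, by simp, d, by simpa [h4] using hr,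
      rfl⟩ ?_).mono ?_
  · rintro n s' ⟨hs', hm, h4', h7, d, hr, rfl⟩ (h0 : s'.reg 7 = s'.reg 11)
    rw [h7, hs'.zero] at h0
    obtain ⟨d, rfl, hr'⟩ := hr.exists_succ h0
    refine .seq <| .load <| .load ⟨3 * d, ⟨by simpa using hs', hm, by simpa using h4', ?_, d, ?_,
      rfl⟩, by omega⟩
    · simp [hm]
    · simpa [hm] using hr'
  · rintro t s' ⟨n, ⟨hs', hm, h4', h7, d, hr, rfl⟩, (hne : s'.reg 7 ≠ s'.reg 11), ht⟩
    rw [h7, hs'.zero] at hne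
    exact ⟨by omega, hs', hm, h4', h7.trans (hr.val_eq hne)⟩

/-- The memory `m` during the computation of the jump links, which are known for the edges numbered
less than `n`. -/
structure Layout.ResolvedBelow (G : Layout T) (n : ℕ) (m : ℕ → ℕ → ℕ) : Prop where
  cells : G.Cells G.M m
  linked : ∀ i : Fin G.M, 2 ≤ (G.edge i).1.slen → G.Linked m i
  ne_zero : ∀ i : Fin G.M, (i : ℕ) < n → 2 ≤ (G.edge i).1.slen → m 7 i ≠ 0

namespace Layout.ResolvedBelow

variable {n : ℕ} {m : ℕ → ℕ → ℕ}

theorem update (h : G.ResolvedBelow n m) {j : Fin G.M} {a : ℕ} (ha : G.JumpAddr j a) :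
    G.ResolvedBelow n (Function.update m 7 (Function.update (m 7) j a)) where
  cells i hi := by simpa using h.cells i hi
  linked i hi := (h.linked i hi).update ha
  ne_zero i hi hlen := by
    rcases eq_or_ne i j with rfl | hij
    · simpa using ha.ne_zero
    · simpa [Fin.val_injective.ne hij] using h.ne_zero i hi hlen

theorem succ {i : Fin G.M} (h : G.ResolvedBelow i m) (hi : 2 ≤ (G.edge i).1.slen → m 7 i ≠ 0) :
    G.ResolvedBelow (i + 1) m where
  cells := h.cells
  linked := h.linked
  ne_zero j hj hlen := by
    rcases Nat.lt_succ_iff_lt_or_eq.1 hj with hj | hj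
    · exact h.ne_zero j hj hlen
    · obtain rfl := Fin.ext hj
      exact hi hlen

theorem jumpsStored {s : State} (h : G.ResolvedBelow G.M s.mem) : G.JumpsStored s :=
  h.cells.jumpsStored fun i hi => (h.linked i hi).jumpAddr (h.ne_zero i i.2 hi)

/-- One iteration of the path compression, in which the jump link of the edge `j` becomes known. -/
theorem exists_compress (h : G.ResolvedBelow n m) {j : Fin G.M} (hj : 2 ≤ (G.edge j).1.slen)
    (h0 : m 7 j = 0) {d a : ℕ} (hr : FirstNonzero (m 7) (m 10) j d a) :
    ∃ (k : Fin G.M) (d' : ℕ), m 10 j = k ∧ d = d' + 1 ∧ 2 ≤ (G.edge k).1.slen ∧ a ≠ 0 ∧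
      numZeros G.M (Function.update (m 7) j a) + 1 = numZeros G.M (m 7) ∧
      FirstNonzero (Function.update (m 7) j a) (m 10) k d' a ∧
      G.ResolvedBelow n (Function.update m 7 (Function.update (m 7) j a)) := by
  obtain ⟨k, hk, hsuf⟩ := (h.linked j hj).exists_isESuf h0
  obtain ⟨d', rfl, hr'⟩ := hr.exists_succ h0
  have ha : G.JumpAddr j a := hr.jumpAddr h.linked hj
  rw [hk] at hr'
  exact ⟨k, d', hk, rfl, by rwa [Edge.slen, hsuf.lab_eq], ha.ne_zero,
    numZeros_update_add_one j.2 h0 ha.ne_zero, hr'.update hr (Nat.lt_succ_self d') a, h.update ha⟩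

end Layout.ResolvedBelow

theorem compressPath_spec {s : State} (hs : G.Env s) {i : Fin G.M} {n d a : ℕ}
    (h4 : s.reg 4 = i) (h7 : s.reg 7 = a) (hi : 2 ≤ (G.edge i).1.slen)
    (hm : G.ResolvedBelow n s.mem) (hr : FirstNonzero (s.mem 7) (s.mem 10) i d a) :
    WP G.cmp w compressPath (fun t s' => t ≤ 4 * d + 3 ∧ G.Env s' ∧ s'.reg 4 = i ∧
      G.ResolvedBelow n s'.mem ∧ s'.mem 7 i ≠ 0 ∧
      numZeros G.M (s'.mem 7) + d = numZeros G.M (s.mem 7)) s := by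
  refine .seq <| .copy <| .seq <| .load <| (WP.while (n := 4 * d) (fun n' s' => G.Env s' ∧
    s'.reg 4 = i ∧ s'.reg 7 = a ∧ G.ResolvedBelow n s'.mem ∧ ∃ (j : Fin G.M) (d' : ℕ),
      s'.reg 6 = j ∧ s'.reg 8 = s'.mem 7 j ∧ 2 ≤ (G.edge j).1.slen ∧ (j = i ∨ s'.mem 7 i ≠ 0) ∧
      FirstNonzero (s'.mem 7) (s'.mem 10) j d' a ∧
      numZeros G.M (s'.mem 7) + d = numZeros G.M (s.mem 7) + d' ∧ n' = 4 * d')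
    ⟨by simpa using hs, by simpa using h4, by simpa using h7, by simpa using hm, i, d,
      by simpa using h4, by simp [h4], hi, .inl rfl, by simpa using hr, by simp, rfl⟩ ?_).mono ?_
  · rintro n' s' ⟨hs', h4', h7', hm', j, d', h6, h8, hj, hor, hr', hz, rfl⟩
      (h0 : s'.reg 8 = s'.reg 11)
    rw [h8, hs'.zero] at h0
    obtain ⟨k, d', hk, rfl, hklen, ha, hz', hr', hm'⟩ := hm'.exists_compress hj h0 hr'
    refine .seq <| .store <| .seq <| .load <| .load ⟨4 * d', ⟨by simpa using hs',
      by simpa using h4', by simpa using h7', by simpa [h6, h7'] using hm', k, d',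
      by simpa [h6] using hk, by simp [h6, hk], hklen, .inr ?_, by simpa [h6, h7'] using hr', ?_,
      rfl⟩, by omega⟩
    · rcases eq_or_ne i j with rfl | hij
      · simpa [h6, h7'] using ha
      · simpa [h6, Fin.val_injective.ne hij] using hor.resolve_left hij.symm
    · simp only [State.setReg_mem, State.setMem_mem, Function.update_self, h6, h7']
      omega
  · rintro t s' ⟨n', ⟨hs', h4', -, hm', j, d', -, h8, -, hor, hr', hz, rfl⟩,
      (hne : s'.reg 8 ≠ s'.reg 11), ht⟩
    rw [h8, hs'.zero] at hne
    obtain rfl := hr'.eq_zero_iff.2 hne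
    refine ⟨by omega, hs', h4', hm', hor.elim ?_ id, by omega⟩
    rintro rfl
    exact hne

theorem resolveEdge_spec {s : State} (hs : G.Env s) {i : Fin G.M} (h4 : s.reg 4 = i)
    (hi : 2 ≤ (G.edge i).1.slen) (hm : G.ResolvedBelow i s.mem) :
    WP G.cmp w (.seq findJump compressPath) (fun t s' => G.Env s' ∧ s'.reg 4 = i ∧
      G.ResolvedBelow (i + 1) s'.mem ∧
      t + 7 * numZeros G.M (s'.mem 7) ≤ 7 * numZeros G.M (s.mem 7) + 6) s := by
  obtain ⟨d, a, hr⟩ := G.exists_firstNonzero hm.linked hi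
  refine .seq <| (findJump_spec hs h4 hr).mono ?_
  rintro t s₁ ⟨ht, hs₁, hmem, h4₁, h7⟩
  rw [← hmem] at hm hr ⊢
  refine (compressPath_spec hs₁ h4₁ h7 hi hm hr).mono ?_
  rintro t' s₂ ⟨ht', hs₂, h4₂, hm₂, hne, hz⟩
  exact ⟨hs₂, h4₂, hm₂.succ fun _ => hne, by omega⟩

theorem resolveEdges_spec {s : State} (hs : G.Env s) (hw : G.M < 2 ^ w)
    (hm : G.ResolvedBelow 0 s.mem) :
    WP G.cmp w (forEdges (ifLong (.seq findJump compressPath))) (fun t s' =>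
      t ≤ 17 * G.M + 2 ∧ G.Env s' ∧ G.ResolvedBelow G.M s'.mem) s := by
  refine (forEdges_spec 8 (fun m => 7 * numZeros G.M (m 7)) G.ResolvedBelow hs hw hm
    fun i s hs h4 hi => ifLong_spec hs h4 (fun hlt => ?_) fun hlen => ?_).mono ?_
  · exact ⟨by simpa using hs, by simpa using h4, hi.succ fun h => absurd hlt h.not_gt,
      Nat.add_comm 3 _ ▸ Nat.add_le_add_left (by norm_num) _⟩
  · have hs₁ : G.Env (s.setReg 5 (G.edge i).1.slen) := by simpa using hs
    refine (resolveEdge_spec hs₁ (by simpa using h4) hlen hi).mono ?_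
    rintro t s' ⟨hs', h4', hi', ht⟩
    rw [State.setReg_mem] at ht
    exact ⟨hs', h4', hi', by omega⟩
  · rintro t s' ⟨hs', hm', ht⟩
    have hz := numZeros_le G.M (s.mem 7)
    exact ⟨by omega, hs', hm'⟩

end Layout

/-! ### Total running time -/

theorem jumpProgram_spec [Fintype α] [Preorder α] {T : List α} {G : Layout T} {w : ℕ} {s : State}
    (hs : G.Stored s) (hw : 2 * G.M + 3 ≤ 2 ^ w) :
    WP G.cmp w jumpProgram (fun t s' => t ≤ (6 * Nat.clog 2 (Fintype.card α) + 42) * G.M + 9 ∧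
      G.Stored s' ∧ G.JumpsStored s') s := by
  have hs₀ : G.Env (((s.setReg 2 1).setReg 3 2).setReg 11 0) :=
    ⟨hs.of_eq (by simp) (by simp) fun _ _ => rfl, by simp, by simp, by simp⟩
  refine .seq <| .const (by omega) <| .seq <| .const (by omega) <| .seq <| .const (by omega) <|
    .seq <| (writeCells_spec hs₀ (by omega)).mono ?_
  rintro t₁ s₁ ⟨ht₁, hs₁, hcells, hzero⟩
  have hlink : G.LinkedBelow 0 s₁.mem :=
    ⟨hcells, fun _ h => absurd h (Nat.not_lt_zero _), fun i _ => hzero i⟩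
  refine .seq <| (linkEdges_spec hs₁ (by omega) hlink).mono ?_
  rintro t₂ s₂ ⟨ht₂, hs₂, hlinked⟩
  have hres : G.ResolvedBelow 0 s₂.mem :=
    ⟨hlinked.cells, fun i => hlinked.linked i i.2, fun _ h => absurd h (Nat.not_lt_zero _)⟩
  refine (resolveEdges_spec hs₂ (by omega) hres).mono ?_
  rintro t₃ s₃ ⟨ht₃, hs₃, hresolved⟩
  rw [add_mul] at ht₂ ⊢
  exact ⟨by omega, hs₃.stored, hresolved.jumpsStored⟩

theorem EndsWithUniqueChar.ne_nil {T : List α} (h : EndsWithUniqueChar T) : T ≠ [] := by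
  obtain ⟨S, d, rfl, -⟩ := h
  exact List.append_ne_nil_of_right_ne_nil S (List.cons_ne_nil d [])

theorem clog_le_two_mul_logb {n : ℕ} (hn : 2 ≤ n) : (Nat.clog 2 n : ℝ) ≤ 2 * Real.logb 2 n := by
  have hn' : (2 : ℝ) ≤ n := by exact_mod_cast hn
  have hlog : 1 ≤ Real.logb 2 n := by
    rwa [Real.le_logb_iff_rpow_le one_lt_two (zero_lt_two.trans_le hn'), Real.rpow_one]
  have hceil := Nat.ceil_lt_add_one (zero_le_one.trans hlog)
  have hclog := Real.natCeil_logb_natCast 2 n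
  rw [Nat.cast_ofNat] at hclog
  rw [hclog] at hceil
  linarith

theorem jumpProgram_time_le {n M e : ℕ} (hn : 2 ≤ n) (hM : 0 < M) (hMe : M ≤ e) :
    (((6 * Nat.clog 2 n + 42) * M + 9 : ℕ) : ℝ) ≤ 114 * e * Real.logb 2 n := by
  have hq : 1 ≤ Nat.clog 2 n := Nat.clog_pos one_lt_two hn
  have hnat : (6 * Nat.clog 2 n + 42) * M + 9 ≤ 57 * (e * Nat.clog 2 n) := by
    nlinarith [Nat.mul_le_mul_right (Nat.clog 2 n) hMe, Nat.mul_le_mul_left M hq]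
  calc (((6 * Nat.clog 2 n + 42) * M + 9 : ℕ) : ℝ) ≤ 57 * (e * Nat.clog 2 n) := by
        exact_mod_cast hnat
    _ ≤ 57 * (e * (2 * Real.logb 2 n)) := by gcongr; exact clog_le_two_mul_logb hn
    _ = 114 * e * Real.logb 2 n := by ring

end LCDAWG

theorem mainTheorem4_general :
    (∀ (α : Type u) (T : List α), ∀ e : Edge α, IsEdge T e → 2 ≤ e.slen →
      ∃ p : List (Edge α), IsJump T e p ∧ (∀ q, IsJump T e q → q = p) ∧
        (∃ v w, IsPath T v p w) ∧ 2 ≤ p.length ∧ pathLab p = e.lab) ∧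
    ∃ (prog : Prog) (C : ℕ),
      ∀ (α : Type u) [Fintype α] [Preorder α] (T : List α), 2 ≤ Fintype.card α → T ≠ [] →
        ∀ (G : Layout T) (w : ℕ), C * numExtensions T ≤ 2 ^ w →
        ∀ s : State, s.IsWordState w → G.Stored s →
          ∃ (t : ℕ) (s' : State), Exec G.cmp w prog s t s' ∧
            (t : ℝ) ≤ C * (numExtensions T : ℝ) * Real.logb 2 (Fintype.card α) ∧
            G.Stored s' ∧ G.JumpsStored s' := by
  refine ⟨fun α T e he hlen => ?_, jumpProgram, 114, fun α _ _ T hσ hT G w hw s hs hG => ?_⟩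
  · obtain ⟨p, hp, hpath, hlen, hlab⟩ := he.exists_jump hlen
    exact ⟨p, hp, fun q hq => hq.unique hp, hpath, hlen, hlab⟩
  · have hM : 0 < G.M := G.M_pos hT
    have hMe : G.M ≤ numExtensions T := G.M_le_numExtensions
    obtain ⟨t, s', hexec, -, ht, hG', hJ⟩ := jumpProgram_spec hG (w := w) (by omega) hs
    refine ⟨t, s', hexec, (Nat.cast_le.2 ht).trans ?_, hG', hJ⟩
    exact_mod_cast jumpProgram_time_le hσ hM hMe

theorem mainTheorem4 :
    (∀ (α : Type u) [Fintype α] [LinearOrder α] (T : List α),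
      2 ≤ Fintype.card α → EndsWithUniqueChar T →
      ∀ e : Edge α, IsEdge T e → 2 ≤ e.slen →
        ∃ p : List (Edge α), IsJump T e p ∧ (∀ q, IsJump T e q → q = p) ∧
          (∃ v w, IsPath T v p w) ∧ 2 ≤ p.length ∧ pathLab p = e.lab) ∧
    ∃ (prog : Prog) (C : ℕ),
      ∀ (α : Type u) [Fintype α] [LinearOrder α] (T : List α),
        2 ≤ Fintype.card α → EndsWithUniqueChar T →
        ∀ (G : Layout T) (w : ℕ), C * (T.length + numExtensions T) ≤ 2 ^ w →
        ∀ s : State, s.IsWordState w → G.Stored s →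
          ∃ (t : ℕ) (s' : State), Exec G.cmp w prog s t s' ∧
            (t : ℝ) ≤ C * (numExtensions T : ℝ) * Real.logb 2 (Fintype.card α) ∧
            G.Stored s' ∧ G.JumpsStored s' := by
  obtain ⟨hjump, prog, C, hprog⟩ := mainTheorem4_general.{u}
  refine ⟨fun α _ _ T _ _ => hjump α T, prog, C, fun α _ _ T hσ hT G w hw => ?_⟩
  exact hprog α T hσ hT.ne_nil G w (by nlinarith)
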